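/- Let $p$ be a prime number, let $K$ be a field of characteristic $p$, and let $G$ be a subgroup of $K^*\times K^*$ (with coordinatewise multiplication) such that $\dim_{\mathbb{Q}}(G\otimes_{\mathbb{Z}}\mathbb{Q})=r$ is finite. Let $a,b\in K^*$. Then the equation $$ax+by=1$$ has at most $31\cdot 19^{r+1}$ solutions $(x,y)\in G$, unless $(a,b)^n\in G$ for some integer $n\ge 1$ with $\gcd(n,p)=1$. -/

import Mathlib

open scoped TensorProduct

/-! ### Padé approximation to powers of `1 - X` in characteristic `p`. -/

section Pade
open Polynomial

/-! Multiplication by `(a, b)` moves the solutions to points `u` of the coset `(a, b) G` with `u.1 +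
u.2 = 1`. If no power of `(a, b)` with exponent prime to `p` lies in `G`, such a point has
transcendental coordinates over the prime field (otherwise it is torsion of order prime to `p`), and
distinct points are never related by Frobenius, since `u ^ p ^ n = u'` puts `(a, b) ^ (p ^ n - 1)`
in `G`.

A family of places with a product formula (`exists_places`) gives a logarithmic map `φ` from these
points to a real normed space. The image spans dimension at most `r + 1`, the extra one coming from
the coset. The ultrametric inequality gives `h (-φ u) = 2 * h (φ u)` for the height `h`, so after
division by the height all points lie on one sphere.

The points repel each other. A nonzero determinant formed from Padé approximants, fed to the product
formula, yields `d * h (φ u) ≤ h (φ u' - 2d • φ u)` (`mul_logHeight_le_sub`); trivial approximants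
yield `h (φ u) ≤ h (φ u' - φ u)` (`logHeight_le_sub`). The approximants are controlled only for `3 *
d ≤ p`, but Frobenius multiplies `φ u` by `p`, so height ratios can be brought into a range where
these `d` suffice. Two nearly parallel points then have height ratio, up to a power of `p`, in a
short interval away from `1`. Hence a narrow cone around one point contains at most one other
(`card_le_of_repelling`). At most `19 ^ (r + 1)` cones are needed, so there are at most `2 * 19 ^ (r
+ 1)` solutions. -/

/-- In characteristic `p`, the Padé approximation problem for `(1 - X) ^ (2 * d)` at `0` has only
the trivial solution in degrees less than `d`, provided `3 * d ≤ p`. -/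
theorem pade_low_degree_eq_zero {p d : ℕ} [Fact p.Prime] (hd : 1 ≤ d) (hdp : 3 * d ≤ p)
    {P Q R : (ZMod p)[X]} (hQ : Q.natDegree < d) (hR : R.natDegree < d)
    (h : X ^ (2 * d) * Q + (1 - X) ^ (2 * d) * P = R) : P = 0 ∧ Q = 0 := by
  have hX1 : (1 - X : (ZMod p)[X]).natDegree = 1 := by
    rw [← natDegree_neg]; simpa using natDegree_X_sub_C (1 : ZMod p)
  have hX0 : (1 - X : (ZMod p)[X]) ≠ 0 := by
    intro h0; rw [h0] at hX1; simp at hX1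
  have hQ0 : Q = 0 := by
    by_contra hQ0
    -- Differentiating `d` times kills `R`. What remains is divisible by `X ^ d` and by `(1 - X) ^
    -- d`, yet has degree below `2 * d`, so it vanishes.
    have hsum : derivative^[d] (X ^ (2 * d) * Q) + derivative^[d] ((1 - X) ^ (2 * d) * P) = 0 := by
      rw [← iterate_map_add, h, iterate_derivative_eq_zero hR]
    have h1 : X ^ d ∣ derivative^[d] (X ^ (2 * d) * Q) := by
      have := pow_sub_dvd_iterate_derivative_of_pow_dvd (p := X ^ (2 * d) * Q) (q := X) (n := 2 * d)
        d (dvd_mul_right _ _)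
      rwa [show 2 * d - d = d by lia] at this
    have h2 : (1 - X) ^ d ∣ derivative^[d] (X ^ (2 * d) * Q) := by
      have := pow_sub_dvd_iterate_derivative_of_pow_dvd (p := (1 - X) ^ (2 * d) * P) (q := 1 - X)
        (n := 2 * d) d (dvd_mul_right _ _)
      rw [show 2 * d - d = d by lia] at this
      rw [eq_neg_of_add_eq_zero_left hsum]
      exact this.neg_right
    have hcop : IsCoprime ((X : (ZMod p)[X]) ^ d) ((1 - X) ^ d) :=
      IsCoprime.pow ⟨1, 1, by ring⟩
    have h3 := hcop.mul_dvd h1 h2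
    have h4 : derivative^[d] (X ^ (2 * d) * Q) = 0 := by
      by_contra h5
      have h6 := natDegree_le_of_dvd h3 h5
      rw [natDegree_mul (pow_ne_zero _ X_ne_zero) (pow_ne_zero _ hX0), natDegree_pow, natDegree_pow,
        hX1, natDegree_X] at h6
      have h7 := natDegree_iterate_derivative (X ^ (2 * d) * Q) d
      rw [natDegree_mul (pow_ne_zero _ X_ne_zero) hQ0, natDegree_pow, natDegree_X] at h7
      lia
    -- The top coefficient is the leading coefficient of `Q` times `d` consecutive integers, all
    -- below `3 * d ≤ p` and so invertible mod `p`.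
    have h8 := congrArg (fun f => f.coeff (d + Q.natDegree)) h4
    simp only [coeff_iterate_derivative, coeff_zero] at h8
    rw [show d + Q.natDegree + d = Q.natDegree + 2 * d by ring, coeff_X_pow_mul, nsmul_eq_mul] at h8
    rcases mul_eq_zero.1 h8 with h9 | h9
    · rw [ZMod.natCast_eq_zero_iff] at h9
      have h10 : (Q.natDegree + 2 * d).descFactorial d ∣ (Q.natDegree + 2 * d).factorial := by
        rw [← Nat.factorial_mul_descFactorial (show d ≤ Q.natDegree + 2 * d by lia)]
        exact dvd_mul_left _ _
      have := ((Fact.out : p.Prime).dvd_factorial).1 (h9.trans h10)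
      lia
    · exact hQ0 (leadingCoeff_eq_zero.1 h9)
  refine ⟨?_, hQ0⟩
  by_contra hP0
  rw [hQ0, mul_zero, zero_add] at h
  have := congrArg natDegree h
  rw [natDegree_mul (pow_ne_zero _ hX0) hP0, natDegree_pow, hX1] at this
  lia

/-- For `3 * d ≤ p` there are two independent Padé approximations of degree at most `d`. -/
theorem exists_pade_pair {p d : ℕ} [Fact p.Prime] (hd : 1 ≤ d) (hdp : 3 * d ≤ p) :
    ∃ P Q R : Fin 2 → (ZMod p)[X], (∀ i, (P i).natDegree ≤ d ∧ (Q i).natDegree ≤ d ∧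
      (R i).natDegree ≤ d ∧ X ^ (2 * d) * Q i + (1 - X) ^ (2 * d) * P i = R i) ∧
      Q 0 * P 1 - Q 1 * P 0 ≠ 0 := by
  let D := degreeLT (ZMod p) (d + 1)
  have hfin (n : ℕ) : Module.finrank (ZMod p) (degreeLT (ZMod p) n) = n := by
    simp [LinearEquiv.finrank_eq (degreeLTEquiv (ZMod p) n)]
  have hfd (n : ℕ) : Module.Finite (ZMod p) (degreeLT (ZMod p) n) :=
    Module.Finite.equiv (degreeLTEquiv (ZMod p) n).symm
  have hdeg (f : D) : (f : (ZMod p)[X]).natDegree ≤ d := by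
    have := mem_degreeLT.1 f.2
    by_contra h
    push Not at h
    exact absurd this (not_lt.2 ((by exact_mod_cast h : ((d + 1 : ℕ) : WithBot ℕ) ≤ _).trans
      (le_degree_of_ne_zero (by
        rw [coeff_natDegree, leadingCoeff_ne_zero]; rintro h0; simp [h0] at h))))
  have hX1 : (1 - X : (ZMod p)[X]).natDegree = 1 := by
    rw [← natDegree_neg]; simpa using natDegree_X_sub_C (1 : ZMod p)
  let f : (D × D × D) →ₗ[ZMod p] (ZMod p)[X] :=
    LinearMap.mulLeft (ZMod p) ((1 - X) ^ (2 * d)) ∘ₗ D.subtype ∘ₗ LinearMap.fst _ _ _ +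
    LinearMap.mulLeft (ZMod p) (X ^ (2 * d)) ∘ₗ D.subtype ∘ₗ LinearMap.fst _ _ _ ∘ₗ
      LinearMap.snd _ _ _ - D.subtype ∘ₗ LinearMap.snd _ _ _ ∘ₗ LinearMap.snd _ _ _
  have hf (v : D × D × D) : f v = (1 - X) ^ (2 * d) * (v.1 : (ZMod p)[X]) +
      X ^ (2 * d) * (v.2.1 : (ZMod p)[X]) - (v.2.2 : (ZMod p)[X]) := rfl
  have hrange : LinearMap.range f ≤ degreeLT (ZMod p) (3 * d + 1) := by
    rintro _ ⟨v, rfl⟩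
    rw [hf, mem_degreeLT]
    refine degree_le_natDegree.trans_lt ?_
    have h1 : ((1 - X : (ZMod p)[X]) ^ (2 * d) * v.1).natDegree ≤ 3 * d := by
      refine natDegree_mul_le.trans ?_
      have := hdeg v.1
      rw [natDegree_pow, hX1]; lia
    have h2 : ((X : (ZMod p)[X]) ^ (2 * d) * v.2.1).natDegree ≤ 3 * d := by
      refine natDegree_mul_le.trans ?_
      have := hdeg v.2.1
      rw [natDegree_pow, natDegree_X]; lia
    have h3 : (v.2.2 : (ZMod p)[X]).natDegree ≤ 3 * d := (hdeg v.2.2).trans (by lia)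
    have := (natDegree_sub_le_of_le (natDegree_add_le_of_degree_le h1 h2) h3)
    exact_mod_cast Nat.lt_succ_of_le (by simpa using this)
  -- There are `3 * (d + 1)` unknown coefficients and `3 * d + 1` linear conditions.
  have hker : 2 ≤ Module.finrank (ZMod p) (LinearMap.ker f) := by
    have h1 := LinearMap.finrank_range_add_finrank_ker f
    have h2 := Submodule.finrank_mono hrange
    rw [hfin] at h2
    rw [Module.finrank_prod, Module.finrank_prod, hfin] at h1
    lia
  let g : LinearMap.ker f →ₗ[ZMod p] (ZMod p × ZMod p) :=
    ((lcoeff (ZMod p) 0 ∘ₗ D.subtype ∘ₗ LinearMap.fst _ _ _).prod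
      (lcoeff (ZMod p) 0 ∘ₗ D.subtype ∘ₗ LinearMap.fst _ _ _ ∘ₗ LinearMap.snd _ _ _)) ∘ₗ
      (LinearMap.ker f).subtype
  have hg (v : LinearMap.ker f) : g v = ((v.1.1 : (ZMod p)[X]).coeff 0,
    (v.1.2.1 : (ZMod p)[X]).coeff 0) := rfl
  have hrel (v : LinearMap.ker f) :
      X ^ (2 * d) * (v.1.2.1 : (ZMod p)[X]) + (1 - X) ^ (2 * d) * (v.1.1 : (ZMod p)[X]) =
        (v.1.2.2 : (ZMod p)[X]) := by
    have := v.2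
    rw [LinearMap.mem_ker, hf, sub_eq_zero] at this
    rw [← this]; ring
  -- If `P` and `Q` vanish at `0`, so does `R`; dividing by `X` gives degrees below `d`, where only
  -- the zero solution exists.
  have hinj : Function.Injective g := by
    rw [injective_iff_map_eq_zero]
    intro v hv
    rw [hg, Prod.mk_eq_zero] at hv
    have hr : (v.1.2.2 : (ZMod p)[X]).coeff 0 = 0 := by
      rw [← hrel, coeff_zero_eq_eval_zero]
      simp only [eval_add, eval_mul, eval_pow, ← coeff_zero_eq_eval_zero]
      rw [hv.1, hv.2]; simp
    obtain ⟨P, hP⟩ := X_dvd_iff.2 hv.1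
    obtain ⟨Q, hQ⟩ := X_dvd_iff.2 hv.2
    obtain ⟨R, hR⟩ := X_dvd_iff.2 hr
    have hlt (F G : (ZMod p)[X]) (hF : F.natDegree ≤ d) (hFG : F = X * G) : G.natDegree < d := by
      rcases eq_or_ne G 0 with rfl | hG
      · simpa using Nat.pos_of_ne_zero (by lia)
      · rw [hFG, natDegree_X_mul hG] at hF; lia
    have := pade_low_degree_eq_zero (P := P) hd hdp (hlt _ _ (hdeg _) hQ)
      (hlt _ _ (hdeg _) hR) (by
        have := hrel v
        rw [hP, hQ, hR] at this
        refine mul_left_cancel₀ (X_ne_zero (R := ZMod p)) ?_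
        rw [← this]; ring)
    have e1 : v.1.1 = 0 := Subtype.ext (by rw [hP, this.1]; simp)
    have e2 : v.1.2.1 = 0 := Subtype.ext (by rw [hQ, this.2]; simp)
    have e3 : v.1.2.2 = 0 := Subtype.ext (by rw [← hrel, e1, e2]; simp)
    exact Subtype.ext (Prod.ext e1 (Prod.ext e2 e3))
  have hsurj : Function.Surjective g := by
    rw [← LinearMap.range_eq_top]
    apply Submodule.eq_top_of_finrank_eq
    have h1 := LinearMap.finrank_range_of_inj hinj
    have h2 := Submodule.finrank_le (LinearMap.range g)
    have h3 : Module.finrank (ZMod p) (ZMod p × ZMod p) = 2 := by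
      rw [Module.finrank_prod, Module.finrank_self]
    lia
  -- These constant terms make the determinant equal to `1` at `0`.
  obtain ⟨v, hv⟩ := hsurj (0, 1)
  obtain ⟨w, hw⟩ := hsurj (1, 0)
  rw [hg, Prod.mk.injEq] at hv hw
  refine ⟨![v.1.1, w.1.1], ![v.1.2.1, w.1.2.1], ![v.1.2.2, w.1.2.2], ?_, ?_⟩
  · intro i
    fin_cases i
    · exact ⟨hdeg _, hdeg _, hdeg _, hrel v⟩
    · exact ⟨hdeg _, hdeg _, hdeg _, hrel w⟩
  · intro h
    have := congrArg (fun q => q.coeff 0) h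
    simp [hv.1, hv.2, hw.1, hw.2, mul_coeff_zero] at this

end Pade

/-! ### Packing and gap arguments for repelling vectors. -/

section Counting
open Module Metric MeasureTheory Function Set ENNReal

/-- A `1/9`-separated set of vectors of norm at most one has at most `19 ^ dim` elements. -/
theorem card_le_of_one_ninth_separated {E : Type*} [NormedAddCommGroup E] [NormedSpace ℝ E]
    [FiniteDimensional ℝ E] (s : Finset E) (hs : ∀ c ∈ s, ‖c‖ ≤ 1)
    (h : ∀ c ∈ s, ∀ d ∈ s, c ≠ d → 1 / 9 ≤ ‖c - d‖) : s.card ≤ 19 ^ finrank ℝ E := by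
  borelize E
  let μ : Measure E := Measure.addHaar
  -- Balls of half the separation are disjoint and lie in the ball of radius `1 + 1 / 18`; the ratio
  -- of radii is `19`.
  let δ : ℝ := (1 : ℝ) / 18
  let ρ : ℝ := (19 : ℝ) / 18
  have ρpos : 0 < ρ := by norm_num [ρ]
  have δpos : 0 < δ := by norm_num [δ]
  set A := ⋃ c ∈ s, ball (c : E) δ with hA
  have D : Set.Pairwise (s : Set E) (Disjoint on fun c => ball (c : E) δ) := by
    rintro c hc d hd hcd
    apply ball_disjoint_ball
    rw [dist_eq_norm]
    convert h c hc d hd hcd using 1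
    norm_num [δ]
  have A_subset : A ⊆ ball (0 : E) ρ := by
    refine iUnion₂_subset fun x hx => ?_
    apply ball_subset_ball'
    calc
      δ + dist x 0 ≤ δ + 1 := by rw [dist_zero_right]; exact add_le_add le_rfl (hs x hx)
      _ = ρ := by norm_num [δ, ρ]
  have I :
    (s.card : ℝ≥0∞) * ENNReal.ofReal (δ ^ finrank ℝ E) * μ (ball 0 1) ≤
      ENNReal.ofReal (ρ ^ finrank ℝ E) * μ (ball 0 1) :=
    calc
      (s.card : ℝ≥0∞) * ENNReal.ofReal (δ ^ finrank ℝ E) * μ (ball 0 1) = μ A := by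
        rw [hA, measure_biUnion_finset D fun c _ => measurableSet_ball]
        simp only [μ.addHaar_ball_of_pos _ δpos]
        simp only [Finset.sum_const, nsmul_eq_mul, mul_assoc]
      _ ≤ μ (ball (0 : E) ρ) := measure_mono A_subset
      _ = ENNReal.ofReal (ρ ^ finrank ℝ E) * μ (ball 0 1) := by
        simp only [μ.addHaar_ball_of_pos _ ρpos]
  have J : (s.card : ℝ≥0∞) * ENNReal.ofReal (δ ^ finrank ℝ E) ≤ ENNReal.ofReal (ρ ^ finrank ℝ E) :=
    (ENNReal.mul_le_mul_iff_left (measure_ball_pos _ _ zero_lt_one).ne' measure_ball_lt_top.ne).1 I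
  have K : (s.card : ℝ) ≤ (19 : ℝ) ^ finrank ℝ E := by
    have := ENNReal.toReal_le_of_le_ofReal (pow_nonneg ρpos.le _) J
    rw [ENNReal.toReal_mul, ENNReal.toReal_natCast, ENNReal.toReal_ofReal (by positivity)] at this
    have h19 : ρ = 19 * δ := by norm_num [ρ, δ]
    rw [h19, mul_pow] at this
    exact le_of_mul_le_mul_right this (by positivity)
  exact mod_cast K

/-- A positively homogeneous subadditive function. -/
structure IsSublinear {E : Type*} [AddCommGroup E] [Module ℝ E] (h : E → ℝ) : Prop where
  add_le : ∀ x y, h (x + y) ≤ h x + h y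
  smul : ∀ (c : ℝ) x, 0 ≤ c → h (c • x) = c * h x

variable {E : Type*} [NormedAddCommGroup E] [NormedSpace ℝ E]

/-- If `e`, `f` are unit vectors for `h` close to one another, then `h (t • f - m • e)` is small. -/
theorem IsSublinear.smul_sub_smul_le {h : E → ℝ} (hh : IsSublinear h) {e f : E} {m t ε : ℝ}
    (hm : 0 ≤ m) (hmt : m ≤ t) (hf : h f = 1) (hef : h (f - e) ≤ ε) :
    h (t • f - m • e) ≤ m * ε + (t - m) := by
  have : t • f - m • e = m • (f - e) + (t - m) • f := by module
  rw [this]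
  refine (hh.add_le _ _).trans ?_
  rw [hh.smul _ _ hm, hh.smul _ _ (by linarith), hf]
  nlinarith

/-- Here the excess points along `-e`, where `h` is `2`, which doubles the linear term. -/
theorem IsSublinear.smul_sub_smul_le' {h : E → ℝ} (hh : IsSublinear h) {e f : E} {m t ε : ℝ}
    (ht : 0 ≤ t) (hmt : t ≤ m) (he : h (-e) = 2) (hef : h (f - e) ≤ ε) :
    h (t • f - m • e) ≤ t * ε + 2 * (m - t) := by
  have : t • f - m • e = t • (f - e) + (m - t) • (-e) := by module
  rw [this]
  refine (hh.add_le _ _).trans ?_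
  rw [hh.smul _ _ ht, hh.smul _ _ (by linarith), he]
  nlinarith

/-- Directions of a repelling configuration that are close have ratio of heights, up to powers
of `p`, in a short interval. -/
theorem ratio_mem_of_close {p : ℕ} {h : E → ℝ} (hh : IsSublinear h) {e f : E} {t : ℝ}
    (he : h (-e) = 2) (hf : h f = 1) (hef : h (f - e) < 2 / 9)
    (ht : 9 / 16 ≤ t) (htp : t < 9 / 16 * p) (h1 : 1 ≤ h (t • f - e))
    (h2 : ∀ d : ℕ, 1 ≤ d → 3 * d ≤ p → d ≤ h (t • f - (2 * d : ℝ) • e)) :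
    23 / 9 < t ∧ t < 27 / 8 := by
  -- Otherwise `h (t • f - e)` is below `t - 7 / 9` if `t ≥ 1`, or below `2 - 16 / 9 * t` if `t ≤
  -- 1`. Both are at most `1`; the second is the source of `9 / 16`.
  have a1 : 16 / 9 < t := by
    by_contra! hle
    rcases le_total 1 t with h' | h'
    · have := hh.smul_sub_smul_le (m := 1) zero_le_one h' hf le_rfl (e := e)
      rw [one_smul] at this
      linarith
    · have := hh.smul_sub_smul_le' (m := 1) (by linarith) h' he le_rfl (f := f)
      rw [one_smul] at this
      nlinarith
  -- Order `d` repulsion excludes the interval from `27 / 16 * d` to `23 / 9 * d`, whose ends solve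
  -- `4 * d - 16 / 9 * t = d` and `t - 14 / 9 * d = d`.
  have key (d : ℕ) (hd : 1 ≤ d) (h3 : 3 * d ≤ p) (hl : 27 / 16 * (d : ℝ) ≤ t) : 23 / 9 * d < t := by
    by_contra! hle
    have hd' : (1 : ℝ) ≤ d := by exact_mod_cast hd
    have := h2 d hd h3
    rcases le_total (2 * d : ℝ) t with h' | h'
    · have := hh.smul_sub_smul_le (m := 2 * d) (by positivity) h' hf le_rfl (e := e)
      nlinarith
    · have := hh.smul_sub_smul_le' (m := 2 * d) (by linarith) h' he le_rfl (f := f)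
      nlinarith
  have hp3 (d : ℕ) (hl : 27 / 16 * (d : ℝ) ≤ t) : 3 * d ≤ p := by
    have : (3 * d : ℝ) < p := by linarith
    exact_mod_cast this.le
  have b1 : 23 / 9 < t := by
    have hl : 27 / 16 * ((1 : ℕ) : ℝ) ≤ t := by push_cast; linarith
    simpa using key 1 le_rfl (hp3 1 hl) hl
  refine ⟨b1, ?_⟩
  by_contra! hle
  have b2 : 46 / 9 < t := by
    have hl : 27 / 16 * ((2 : ℕ) : ℝ) ≤ t := by push_cast; linarith
    have := key 2 (by norm_num) (hp3 2 hl) hl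
    push_cast at this; linarith
  -- From `d = 2` on, consecutive excluded intervals overlap, so the largest `d` whose interval
  -- starts below `t` gives a contradiction.
  have hl : 27 / 16 * ((⌊16 / 27 * t⌋₊ : ℕ) : ℝ) ≤ t := by
    have := Nat.floor_le (show 0 ≤ 16 / 27 * t by linarith)
    linarith
  have h' := Nat.lt_floor_add_one (16 / 27 * t)
  have hpos : 1 ≤ ⌊16 / 27 * t⌋₊ := Nat.le_floor (by push_cast; linarith)
  have := key _ hpos (hp3 _ hl) hl
  linarith

/-- A configuration of vectors repelling each other in the manner of the solutions of a unit
equation in characteristic `p`. -/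
theorem card_le_of_repelling [FiniteDimensional ℝ E] {p : ℕ} (hp : 2 ≤ p) {h : E → ℝ}
    (hh : IsSublinear h) (hnorm : ∀ z, h z ≤ 2 / 3 * ‖z‖) {ι : Type*} (T : Finset ι) (φ : ι → E)
    (hpos : ∀ u ∈ T, 0 < h (φ u)) (hφ : ∀ u ∈ T, ‖φ u‖ = 3 * h (φ u))
    (hneg : ∀ u ∈ T, h (-φ u) = 2 * h (φ u))
    (h1 : ∀ u ∈ T, ∀ u' ∈ T, u ≠ u' → ∀ k : ℤ, h (φ u) ≤ h ((p : ℝ) ^ k • φ u' - φ u))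
    (h2 : ∀ u ∈ T, ∀ u' ∈ T, ∀ k : ℤ, ∀ d : ℕ, 1 ≤ d → 3 * d ≤ p →
      d * h (φ u) ≤ h ((p : ℝ) ^ k • φ u' - (2 * d : ℝ) • φ u)) :
    T.card ≤ 2 * 19 ^ finrank ℝ E := by
  classical
  let e : ι → E := fun u => (h (φ u))⁻¹ • φ u
  have hφe (u) (hu : u ∈ T) : φ u = h (φ u) • e u := by
    simp only [e]; rw [smul_inv_smul₀ (hpos u hu).ne']
  have he1 (u) (hu : u ∈ T) : h (e u) = 1 := by
    simp only [e]
    rw [hh.smul _ _ (inv_nonneg.2 (hpos u hu).le), inv_mul_cancel₀ (hpos u hu).ne']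
  have he2 (u) (hu : u ∈ T) : h (-e u) = 2 := by
    simp only [e]
    rw [← smul_neg, hh.smul _ _ (inv_nonneg.2 (hpos u hu).le), hneg u hu]
    field_simp [(hpos u hu).ne']
  have he3 (u) (hu : u ∈ T) : ‖e u‖ = 3 := by
    simp only [e]
    rw [norm_smul, hφ u hu, norm_inv, Real.norm_of_nonneg (hpos u hu).le]
    field_simp [(hpos u hu).ne']
  have hp1 : (1 : ℝ) < p := by exact_mod_cast hp
  -- the unit form of the hypotheses
  have scale (u) (hu : u ∈ T) (u') (hu' : u' ∈ T) (k : ℤ) (m : ℝ) :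
      h ((p : ℝ) ^ k • φ u' - m • φ u) =
        h (φ u) * h (((p : ℝ) ^ k * h (φ u') / h (φ u)) • e u' - m • e u) := by
    rw [← hh.smul _ _ (hpos u hu).le]
    congr 1
    rw [hφe u' hu', hφe u hu, smul_sub]
    simp only [he1 u hu, he1 u' hu', hh.smul _ _ (hpos u hu).le, hh.smul _ _ (hpos u' hu').le,
      smul_smul, mul_one]
    have := (hpos u hu).ne'
    congr 2
    · field_simp
    · ring
  have g1 (u) (hu : u ∈ T) (u') (hu' : u' ∈ T) (hne : u ≠ u') (k : ℤ) :
      1 ≤ h (((p : ℝ) ^ k * h (φ u') / h (φ u)) • e u' - e u) := by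
    have a := h1 u hu u' hu' hne k
    have b := scale u hu u' hu' k 1
    rw [one_smul, one_smul] at b
    rw [b] at a
    exact le_of_mul_le_mul_left (by linarith) (hpos u hu)
  have g2 (u) (hu : u ∈ T) (u') (hu' : u' ∈ T) (k : ℤ) (d : ℕ) (hd : 1 ≤ d) (hdp : 3 * d ≤ p) :
      d ≤ h (((p : ℝ) ^ k * h (φ u') / h (φ u)) • e u' - (2 * d : ℝ) • e u) := by
    have a := h2 u hu u' hu' k d hd hdp
    rw [scale u hu u' hu' k _] at a
    exact le_of_mul_le_mul_left (by linarith) (hpos u hu)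
  have close (u u' : ι) (huu : ‖e u' - e u‖ < 1 / 3) : h (e u' - e u) < 2 / 9 := by
    have := hnorm (e u' - e u); linarith
  have gap (u) (hu : u ∈ T) (u') (hu' : u' ∈ T) (hne : u ≠ u') (huu : ‖e u' - e u‖ < 1 / 3) :
      ∃ k : ℤ, 23 / 9 < (p : ℝ) ^ k * h (φ u') / h (φ u) ∧
        (p : ℝ) ^ k * h (φ u') / h (φ u) < 27 / 8 := by
    -- This power of `p` brings the ratio into the fundamental domain from `9 / 16` to `9 / 16 * p`.
    obtain ⟨k, hk1, hk2⟩ := exists_mem_Ico_zpow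
      (show 0 < 16 / 9 * (h (φ u') / h (φ u)) from mul_pos (by norm_num)
        (div_pos (hpos u' hu') (hpos u hu))) hp1
    have hpk : 0 < (p : ℝ) ^ k := zpow_pos (by linarith) k
    have hq := hpos u hu
    have e1 : (p : ℝ) ^ (-k) * h (φ u') / h (φ u) = (h (φ u') / h (φ u)) / (p : ℝ) ^ k := by
      rw [zpow_neg]; field_simp
    refine ⟨-k, ratio_mem_of_close hh (he2 u hu) (he1 u' hu') (close u u' huu) ?_ ?_
      (g1 u hu u' hu' hne _) (g2 u hu u' hu' _)⟩
    · rw [e1, le_div_iff₀ hpk]; linarith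
    · rw [zpow_add_one₀ (by linarith)] at hk2
      rw [e1, div_lt_iff₀ hpk]; nlinarith
  -- a maximal separated subset
  let S : Finset (Finset ι) := T.powerset.filter
    fun C => ∀ c ∈ C, ∀ c' ∈ C, c ≠ c' → 1 / 3 ≤ ‖e c - e c'‖
  obtain ⟨C, hCS, hCmax⟩ := S.exists_max_image Finset.card ⟨∅, by simp [S]⟩
  simp only [S, Finset.mem_filter, Finset.mem_powerset] at hCS hCmax
  obtain ⟨hCT, hCsep⟩ := hCS
  have hcov (u) (hu : u ∈ T) : ∃ c ∈ C, ‖e u - e c‖ < 1 / 3 := by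
    by_contra! hcon
    have huC : u ∉ C := fun h => by have := hcon u h; norm_num at this
    have := hCmax (insert u C) ⟨Finset.insert_subset hu hCT, by
      intro c hc c' hc' hcc
      rcases Finset.mem_insert.1 hc with rfl | hc₁ <;>
        rcases Finset.mem_insert.1 hc' with rfl | hc₂
      · exact absurd rfl hcc
      · exact hcon _ hc₂
      · rw [norm_sub_rev]; exact hcon _ hc₁
      · exact hCsep _ hc₁ _ hc₂ hcc⟩
    rw [Finset.card_insert_of_notMem huC] at this
    lia
  have hCcard : C.card ≤ 19 ^ finrank ℝ E := by
    -- Scaling by `1 / 3` takes norm `3` to `1` and separation `1 / 3` to `1 / 9`.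
    have hinj : Set.InjOn (fun c => (1 / 3 : ℝ) • e c) C := by
      intro c hc c' hc' hcc
      by_contra hne
      have := hCsep c hc c' hc' hne
      simp only [smul_right_inj (show (1 / 3 : ℝ) ≠ 0 by norm_num)] at hcc
      rw [hcc, sub_self, norm_zero] at this
      norm_num at this
    rw [← Finset.card_image_of_injOn hinj]
    apply card_le_of_one_ninth_separated
    · intro x hx
      obtain ⟨c, hc, rfl⟩ := Finset.mem_image.1 hx
      rw [norm_smul, he3 c (hCT hc)]; norm_num
    · intro x hx y hy hxy
      obtain ⟨c, hc, rfl⟩ := Finset.mem_image.1 hx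
      obtain ⟨c', hc', rfl⟩ := Finset.mem_image.1 hy
      have := hCsep c hc c' hc' (fun h => hxy (by rw [h]))
      rw [← smul_sub, norm_smul]; norm_num; linarith
  choose! γ hγC hγ using hcov
  have hfib : ∀ c ∈ C, (T.filter fun u => γ u = c).card ≤ 2 := by
    intro c hc
    have hcT := hCT hc
    -- Two further points near `c` would have mutual ratio between `1` and `(27 / 8) / (23 / 9) < 3
    -- / 2`, and directions at `h`-distance at most `4 / 9`; repulsion would give `1 ≤ 4 / 9 + 1 /
    -- 2`.
    have hsub : ((T.filter fun u => γ u = c).erase c).card ≤ 1 := by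
      rw [Finset.card_le_one]
      have main (u) (hu : u ∈ (T.filter fun u => γ u = c).erase c) (u')
          (hu' : u' ∈ (T.filter fun u => γ u = c).erase c) (hne : u ≠ u') : False := by
        simp only [Finset.mem_erase, Finset.mem_filter] at hu hu'
        obtain ⟨huc, huT, hγu⟩ := hu
        obtain ⟨huc', huT', hγu'⟩ := hu'
        have d1 := hγ u huT
        have d2 := hγ u' huT'
        rw [hγu] at d1
        rw [hγu'] at d2
        obtain ⟨k, hk1, hk2⟩ := gap c hcT u huT huc.symm d1
        obtain ⟨k', hk1', hk2'⟩ := gap c hcT u' huT' huc'.symm d2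
        have hc0 := hpos c hcT
        have hu0 := hpos u huT
        have hu0' := hpos u' huT'
        have hpp : (0 : ℝ) < p := by linarith
        have hcl (v) (v') (h3 : ‖e v - e c‖ < 1 / 3) (h3' : ‖e v' - e c‖ < 1 / 3) :
            h (e v' - e v) ≤ 4 / 9 := by
          have h4 : ‖e v' - e v‖ ≤ ‖e v' - e c‖ + ‖e v - e c‖ := by
            have := norm_sub_le (e v' - e c) (e v - e c)
            rwa [sub_sub_sub_cancel_right] at this
          have := hnorm (e v' - e v)
          linarith
        have fin (v) (hv : v ∈ T) (v') (hv' : v' ∈ T) (hvv : v ≠ v') (j j' : ℤ)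
            (h3 : ‖e v - e c‖ < 1 / 3) (h3' : ‖e v' - e c‖ < 1 / 3)
            (hj : 23 / 9 < (p : ℝ) ^ j * h (φ v) / h (φ c))
            (hj' : (p : ℝ) ^ j' * h (φ v') / h (φ c) < 27 / 8)
            (hle : (p : ℝ) ^ j * h (φ v) / h (φ c) ≤ (p : ℝ) ^ j' * h (φ v') / h (φ c)) :
            False := by
          have hv0 := hpos v hv
          have hpj : (0 : ℝ) < (p : ℝ) ^ j := zpow_pos hpp j
          have e1 : (p : ℝ) ^ (j' - j) * h (φ v') / h (φ v) =
              ((p : ℝ) ^ j' * h (φ v') / h (φ c)) / ((p : ℝ) ^ j * h (φ v) / h (φ c)) := by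
            rw [zpow_sub₀ hpp.ne']; field_simp
          have hb := g1 v hv v' hv' hvv (j' - j)
          rw [e1] at hb
          set a := (p : ℝ) ^ j * h (φ v) / h (φ c)
          set b := (p : ℝ) ^ j' * h (φ v') / h (φ c)
          have ha : 0 < a := by linarith
          have hab : 1 ≤ b / a := by rw [le_div_iff₀ ha]; linarith
          have hab' : b / a < 3 / 2 := by rw [div_lt_iff₀ ha]; linarith
          have := hh.smul_sub_smul_le zero_le_one hab (he1 v' hv') (hcl v v' h3 h3')
          rw [one_smul] at this
          linarith
        rcases le_total ((p : ℝ) ^ k * h (φ u) / h (φ c)) ((p : ℝ) ^ k' * h (φ u') / h (φ c))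
          with hle | hle
        · exact fin u huT u' huT' hne k k' d1 d2 hk1 hk2' hle
        · exact fin u' huT' u huT hne.symm k' k d2 d1 hk1' hk2 hle
      intro u hu u' hu'
      by_contra hne
      exact main u hu u' hu' hne
    have := Finset.pred_card_le_card_erase (s := T.filter fun u => γ u = c) (a := c)
    lia
  have := Finset.card_le_mul_card_image_of_maps_to (f := γ) (s := T) (t := C) hγC 2 hfib
  lia

end Counting

/-! ### Nonarchimedean absolute values, heights and the repulsion inequalities. -/

section Places
open Polynomial

variable {K : Type*} [Field K]

theorem IsNonarchimedean.abv_sub_le {v : AbsoluteValue K ℝ} (hv : IsNonarchimedean v) (x y : K) :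
    v (x - y) ≤ max (v x) (v y) := by
  simpa [sub_eq_add_neg] using hv x (-y)

/-- A polynomial with integral coefficients is bounded in terms of its degree. -/
theorem IsNonarchimedean.abv_eval_le {v : AbsoluteValue K ℝ} (hv : IsNonarchimedean v) {P : K[X]}
    (hP : ∀ n, v (P.coeff n) ≤ 1) {d : ℕ} (hd : P.natDegree ≤ d) {x : K} {H : ℝ} (h1 : 1 ≤ H)
    (hx : v x ≤ H) : v (P.eval x) ≤ H ^ d := by
  rw [eval_eq_sum_range]
  refine Finset.sum_induction _ (fun z => v z ≤ H ^ d) (fun a b ha hb => (hv a b).trans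
    (max_le ha hb)) (by rw [map_zero]; positivity) ?_
  intro i hi
  rw [map_mul, map_pow]
  calc v (P.coeff i) * v x ^ i ≤ 1 * H ^ i := by gcongr; exact hP i
    _ = H ^ i := one_mul _
    _ ≤ H ^ d := pow_le_pow_right₀ h1 (by have := Finset.mem_range.1 hi; lia)

/-- Integral elements have absolute value at most one. -/
theorem IsNonarchimedean.abv_le_one_of_monic {v : AbsoluteValue K ℝ} (hv : IsNonarchimedean v)
    {P : K[X]} (hm : P.Monic) (hP : ∀ n, v (P.coeff n) ≤ 1) {x : K} (hx : P.eval x = 0) :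
    v x ≤ 1 := by
  by_contra! hlt
  rcases Nat.eq_zero_or_pos P.natDegree with h0 | h0
  · rw [Polynomial.Monic.natDegree_eq_zero hm] at h0
    simp [h0] at hx
  have h1 := hv.abv_eval_le (P := P.eraseLead) (d := P.natDegree - 1) (H := v x) (x := x)
    (fun n => by rw [eraseLead_coeff]; split_ifs <;> simp [hP]) (eraseLead_natDegree_le P) hlt.le
    le_rfl
  have h2 : P.eraseLead.eval x = - x ^ P.natDegree := by
    rw [← eraseLead_add_C_mul_X_pow P, hm.leadingCoeff] at hx
    rw [eq_neg_iff_add_eq_zero]; simpa using hx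
  rw [h2, AbsoluteValue.map_neg, map_pow] at h1
  have := pow_lt_pow_right₀ hlt (show P.natDegree - 1 < P.natDegree by lia)
  linarith

theorem IsNonarchimedean.abv_natCast_le_one {v : AbsoluteValue K ℝ} (hv : IsNonarchimedean v)
    (n : ℕ) : v (n : K) ≤ 1 := by
  induction n with
  | zero => simp
  | succ n ih => push_cast; exact (hv _ _).trans (max_le ih (by simp))

theorem IsNonarchimedean.abv_algebraMap_zmod_le_one {p : ℕ} [Fact p.Prime] [Algebra (ZMod p) K]
    {v : AbsoluteValue K ℝ} (hv : IsNonarchimedean v) (c : ZMod p) :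
    v (algebraMap (ZMod p) K c) ≤ 1 := by
  obtain ⟨n, rfl⟩ := ZMod.natCast_zmod_surjective c
  rw [map_natCast]
  exact hv.abv_natCast_le_one n

theorem IsNonarchimedean.transcendental_of_one_lt {p : ℕ} [Fact p.Prime] [Algebra (ZMod p) K]
    {v : AbsoluteValue K ℝ} (hv : IsNonarchimedean v) {x : K} (hx : 1 < v x) :
    Transcendental (ZMod p) x := by
  intro hal
  have h := hv.abv_le_one_of_monic (P := (minpoly (ZMod p) x).map (algebraMap (ZMod p) K)) (x := x)
    ((minpoly.monic hal.isIntegral).map _)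
    (fun n => by rw [coeff_map]; exact hv.abv_algebraMap_zmod_le_one _)
    (by rw [eval_map_algebraMap]; exact minpoly.aeval _ _)
  linarith

/-- The local contribution to the height of `(x, y)`. -/
noncomputable def localHeight (v : AbsoluteValue K ℝ) (x y : K) : ℝ :=
  max 0 (max (Real.log (v x)) (Real.log (v y)))

theorem localHeight_eq_log (v : AbsoluteValue K ℝ) {x y : K} (hx : x ≠ 0) (hy : y ≠ 0) :
    localHeight v x y = Real.log (max 1 (max (v x) (v y))) := by
  have h := Real.strictMonoOn_log.monotoneOn
  have hx' : v x ∈ Set.Ioi (0 : ℝ) := v.pos hx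
  have hy' : v y ∈ Set.Ioi (0 : ℝ) := v.pos hy
  have hm : max (v x) (v y) ∈ Set.Ioi (0 : ℝ) := lt_max_of_lt_left (v.pos hx)
  rw [localHeight, ← h.map_max hx' hy', ← Real.log_one,
    ← h.map_max (Set.mem_Ioi.2 zero_lt_one) hm]

/-- Let `D = αP - βQ`, evaluated at `x`. The two relations give `D * x ^ M = P - βR` and `D * y ^ M
= αR - Q`, so `D`, `D * x ^ M` and `D * y ^ M` satisfy the same upper bound. -/
theorem localHeight_pade_le {p : ℕ} [Fact p.Prime] [Algebra (ZMod p) K]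
    {v : AbsoluteValue K ℝ} (hv : IsNonarchimedean v) {x y α β : K} (hx : x ≠ 0) (hy : y ≠ 0)
    (hα : α ≠ 0) (hβ : β ≠ 0) (hxy : x + y = 1) {M d : ℕ} (hαβ : α * x ^ M + β * y ^ M = 1)
    {P Q R : (ZMod p)[X]} (hP : P.natDegree ≤ d) (hQ : Q.natDegree ≤ d) (hR : R.natDegree ≤ d)
    (hrel : X ^ M * Q + (1 - X) ^ M * P = R) (hD : α * aeval x P - β * aeval x Q ≠ 0) :
    M * localHeight v x y + Real.log (v (α * aeval x P - β * aeval x Q)) ≤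
      localHeight v α β + d * localHeight v x y := by
  rw [localHeight_eq_log v hx hy, localHeight_eq_log v hα hβ]
  set H := max 1 (max (v x) (v y)) with hH
  set h := max 1 (max (v α) (v β)) with hh
  have hrel' : x ^ M * aeval x Q + y ^ M * aeval x P = aeval x R := by
    rw [← hrel, show y = 1 - x by rw [← hxy]; ring]; simp
  have H1 : 1 ≤ H := le_max_left _ _
  have h1 : 1 ≤ h := le_max_left _ _
  have hxH : v x ≤ H := (le_max_left _ _).trans (le_max_right _ _)
  have hαh : v α ≤ h := (le_max_left _ _).trans (le_max_right _ _)
  have hβh : v β ≤ h := (le_max_right _ _).trans (le_max_right _ _)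
  have bd (S : (ZMod p)[X]) (hS : S.natDegree ≤ d) : v (aeval x S) ≤ H ^ d := by
    rw [← eval_map_algebraMap]
    exact hv.abv_eval_le (fun n => by rw [coeff_map]; exact hv.abv_algebraMap_zmod_le_one _)
      (natDegree_map_le.trans hS) H1 hxH
  have bd1 (S : (ZMod p)[X]) (hS : S.natDegree ≤ d) (c : K) (hc : v c ≤ h) :
      v (c * aeval x S) ≤ h * H ^ d := by
    rw [map_mul]
    exact mul_le_mul hc (bd S hS) (v.nonneg _) (by linarith)
  have bd2 (S : (ZMod p)[X]) (hS : S.natDegree ≤ d) : v (aeval x S) ≤ h * H ^ d := by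
    simpa using bd1 S hS 1 (by simpa using h1)
  set D := α * aeval x P - β * aeval x Q with hDdef
  have e0 : v D ≤ h * H ^ d :=
    (hv.abv_sub_le _ _).trans (max_le (bd1 _ hP _ hαh) (bd1 _ hQ _ hβh))
  have e1 : v D * v x ^ M ≤ h * H ^ d := by
    rw [← map_pow, ← map_mul, show D * x ^ M = aeval x P - β * aeval x R by
      rw [hDdef, ← hrel']; linear_combination aeval x P * hαβ]
    exact (hv.abv_sub_le _ _).trans (max_le (bd2 _ hP) (bd1 _ hR _ hβh))
  have e2 : v D * v y ^ M ≤ h * H ^ d := by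
    rw [← map_pow, ← map_mul, show D * y ^ M = α * aeval x R - aeval x Q by
      rw [hDdef, ← hrel']; linear_combination - aeval x Q * hαβ]
    exact (hv.abv_sub_le _ _).trans (max_le (bd1 _ hR _ hαh) (bd2 _ hQ))
  have e3 : v D * H ^ M ≤ h * H ^ d := by
    rcases max_choice (1 : ℝ) (max (v x) (v y)) with hc | hc
    · rw [hH, hc, one_pow, mul_one, ← hc, ← hH]; exact e0
    · rcases max_choice (v x) (v y) with hc' | hc'
      · have hHx : H = v x := by rw [hH, hc, hc']
        rwa [← hHx] at e1
      · have hHx : H = v y := by rw [hH, hc, hc']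
        rwa [← hHx] at e2
  have hDpos : 0 < v D := v.pos hD
  have := Real.log_le_log (by positivity) e3
  rw [Real.log_mul (by positivity) (by positivity), Real.log_mul (by positivity) (by positivity),
    Real.log_pow, Real.log_pow] at this
  linarith

/-- A family of absolute values satisfies the product formula at `z`. -/
def ProductFormulaAt {ι : Type*} (w : ι → AbsoluteValue K ℝ) (z : K) : Prop :=
  ∃ s : Finset ι, (∀ i ∉ s, w i z = 1) ∧ ∏ i ∈ s, w i z = 1

theorem ProductFormulaAt.prod_eq_one {ι : Type*} {w : ι → AbsoluteValue K ℝ} {z : K}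
    (h : ProductFormulaAt w z) {S : Finset ι} (hS : ∀ i ∉ S, w i z = 1) :
    ∏ i ∈ S, w i z = 1 := by
  classical
  obtain ⟨s, hs, hp⟩ := h
  rw [← hp]
  have e1 : ∏ i ∈ S, w i z = ∏ i ∈ S ∪ s, w i z :=
    Finset.prod_subset Finset.subset_union_left fun i _ hi => hS i hi
  have e2 : ∏ i ∈ s, w i z = ∏ i ∈ S ∪ s, w i z :=
    Finset.prod_subset Finset.subset_union_right fun i _ hi => hs i hi
  rw [e1, e2]

theorem ProductFormulaAt.sum_log_eq_zero {ι : Type*} {w : ι → AbsoluteValue K ℝ} {z : K}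
    (hz : z ≠ 0) (h : ProductFormulaAt w z) {S : Finset ι} (hS : ∀ i ∉ S, w i z = 1) :
    ∑ i ∈ S, Real.log (w i z) = 0 := by
  rw [← Real.log_prod fun i _ => ((w i).pos hz).ne', h.prod_eq_one hS, Real.log_one]

variable {ι : Type*}

/-- The space of logarithmic vectors of pairs over the finite set of places `s`, with the third
coordinates recording the logarithms of the quotients. -/
abbrev LogSpace (s : Finset ι) := PiLp 1 fun _ : s => ℝ × ℝ × ℝ

/-- The logarithmic embedding of `Kˣ × Kˣ`. -/
noncomputable def logMap (w : ι → AbsoluteValue K ℝ) (s : Finset ι) :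
    Additive (Kˣ × Kˣ) →+ LogSpace s where
  toFun u := WithLp.toLp 1 fun i => (Real.log (w i u.toMul.1), Real.log (w i u.toMul.2),
    Real.log (w i u.toMul.1) - Real.log (w i u.toMul.2))
  map_zero' := by ext i <;> simp
  map_add' u u' := by
    have h (i : ι) (x : Kˣ) : w i x ≠ 0 := ((w i).pos x.ne_zero).ne'
    ext i <;> simp [Real.log_mul, h]
    ring

/-- The height on the logarithmic space. -/
noncomputable def logHeight (s : Finset ι) (z : LogSpace s) : ℝ :=
  ∑ i, max 0 (max (z i).1 (z i).2.1)

/-- The logarithmic vectors that satisfy the product formula. -/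
def productFormulaSpace (s : Finset ι) : Submodule ℝ (LogSpace s) where
  carrier := {z | ∑ i, (z i).1 = 0 ∧ ∑ i, (z i).2.1 = 0 ∧ ∀ i, (z i).2.2 = (z i).1 - (z i).2.1}
  add_mem' := by
    rintro z z' ⟨h1, h2, h3⟩ ⟨h1', h2', h3'⟩
    refine ⟨by simp [-Finset.univ_eq_attach, Finset.sum_add_distrib, h1, h1'],
      by simp [-Finset.univ_eq_attach, Finset.sum_add_distrib, h2, h2'], fun i => ?_⟩
    simp only [PiLp.add_apply, Prod.fst_add, Prod.snd_add, h3, h3']; ring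
  zero_mem' := by simp
  smul_mem' := by
    rintro c z ⟨h1, h2, h3⟩
    refine ⟨by simp [-Finset.univ_eq_attach, ← Finset.mul_sum, h1],
      by simp [-Finset.univ_eq_attach, ← Finset.mul_sum, h2],
      fun i => ?_⟩
    simp only [PiLp.smul_apply, Prod.smul_fst, Prod.smul_snd, h3, smul_eq_mul]; ring

theorem isSublinear_logHeight (s : Finset ι) : IsSublinear (logHeight s) where
  add_le x y := by
    rw [logHeight, logHeight, logHeight, ← Finset.sum_add_distrib]
    refine Finset.sum_le_sum fun i _ => ?_
    simp only [PiLp.add_apply, Prod.fst_add, Prod.snd_add]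
    grind
  smul c x hc := by
    simp only [logHeight, Finset.mul_sum, PiLp.smul_apply, Prod.smul_fst, Prod.smul_snd,
      smul_eq_mul]
    refine Finset.sum_congr rfl fun i _ => ?_
    rw [mul_max_of_nonneg _ _ hc, mul_max_of_nonneg _ _ hc, mul_zero]

/-- At each place both sides are the spread of the three numbers `0`, `a`, `b`; the third coordinate
of the space supplies `|a - b|`. -/
theorem norm_eq_logHeight_add {s : Finset ι} {z : LogSpace s} (hz : z ∈ productFormulaSpace s) :
    ‖z‖ = logHeight s z + logHeight s (-z) := by
  rw [PiLp.norm_eq_of_L1, logHeight, logHeight, ← Finset.sum_add_distrib]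
  refine Finset.sum_congr rfl fun i _ => ?_
  rw [Prod.norm_def, Prod.norm_def, hz.2.2 i]
  simp only [Real.norm_eq_abs, PiLp.neg_apply, Prod.fst_neg, Prod.snd_neg]
  grind

/-- Termwise, `max(0, a, b) ≤ 2 * max(0, -a, -b) + a + b`, and the linear terms sum to zero. -/
theorem logHeight_le_norm {s : Finset ι} {z : LogSpace s} (hz : z ∈ productFormulaSpace s) :
    logHeight s z ≤ 2 / 3 * ‖z‖ := by
  have h : logHeight s z ≤ 2 * logHeight s (-z) + ∑ i, (z i).1 + ∑ i, (z i).2.1 := by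
    rw [logHeight, logHeight, Finset.mul_sum, ← Finset.sum_add_distrib, ← Finset.sum_add_distrib]
    refine Finset.sum_le_sum fun i _ => ?_
    simp only [PiLp.neg_apply, Prod.fst_neg, Prod.snd_neg]
    grind
  rw [hz.1, hz.2.1] at h
  rw [norm_eq_logHeight_add hz]
  linarith

variable {w : ι → AbsoluteValue K ℝ} {s : Finset ι}

theorem logMap_mem_productFormulaSpace {u : Kˣ × Kˣ} (h1 : ProductFormulaAt w (u.1 : K))
    (h2 : ProductFormulaAt w (u.2 : K)) (hs1 : ∀ i ∉ s, w i u.1 = 1) (hs2 : ∀ i ∉ s, w i u.2 = 1) :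
    logMap w s (.ofMul u) ∈ productFormulaSpace s := by
  refine ⟨?_, ?_, fun i => rfl⟩
  · simpa [logMap] using (Finset.sum_coe_sort s fun i => Real.log (w i u.1)).trans
      (h1.sum_log_eq_zero u.1.ne_zero hs1)
  · simpa [logMap] using (Finset.sum_coe_sort s fun i => Real.log (w i u.2)).trans
      (h2.sum_log_eq_zero u.2.ne_zero hs2)

theorem logHeight_logMap (u : Kˣ × Kˣ) :
    logHeight s (logMap w s (.ofMul u)) = ∑ i ∈ s, localHeight (w i) u.1 u.2 :=
  Finset.sum_coe_sort s fun i => localHeight (w i) u.1 u.2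

/-- For solutions of the unit equation the height of the inverse is twice the height. -/
theorem logHeight_neg_logMap (hw : ∀ i, IsNonarchimedean (w i)) {u : Kˣ × Kˣ}
    (hu : (u.1 + u.2 : K) = 1) (hz : logMap w s (.ofMul u) ∈ productFormulaSpace s) :
    logHeight s (-logMap w s (.ofMul u)) = 2 * logHeight s (logMap w s (.ofMul u)) := by
  set z := logMap w s (.ofMul u) with hzdef
  have h : logHeight s (-z) + ∑ i, (z i).1 + ∑ i, (z i).2.1 = 2 * logHeight s z := by
    rw [logHeight, logHeight, Finset.mul_sum, ← Finset.sum_add_distrib, ← Finset.sum_add_distrib]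
    refine Finset.sum_congr rfl fun i _ => ?_
    have e1 : (z i).1 = Real.log (w i u.1) := rfl
    have e2 : (z i).2.1 = Real.log (w i u.2) := rfl
    have p1 := (w i).pos u.1.ne_zero
    have p2 := (w i).pos u.2.ne_zero
    -- Since `u.1 + u.2 = 1`, the largest of `1`, `|u.1|`, `|u.2|` is attained at least twice, which
    -- makes the local identity exact.
    have a0 := hw i u.1 u.2
    rw [hu, map_one] at a0
    have a1 := (hw i).abv_sub_le 1 u.2
    rw [← hu, add_sub_cancel_right, hu, map_one] at a1
    have a2 := (hw i).abv_sub_le 1 u.1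
    rw [← hu, add_sub_cancel_left, hu, map_one] at a2
    have b0 : 0 ≤ max (z i).1 (z i).2.1 := by
      rw [e1, e2]
      rcases le_max_iff.1 a0 with h | h
      · exact le_max_of_le_left (Real.log_nonneg h)
      · exact le_max_of_le_right (Real.log_nonneg h)
    have b1 : (z i).1 ≤ max 0 (z i).2.1 := by
      rw [e1, e2]
      rcases le_max_iff.1 a1 with h | h
      · exact le_max_of_le_left (Real.log_nonpos p1.le h)
      · exact le_max_of_le_right (Real.log_le_log p1 h)
    have b2 : (z i).2.1 ≤ max 0 (z i).1 := by
      rw [e1, e2]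
      rcases le_max_iff.1 a2 with h | h
      · exact le_max_of_le_left (Real.log_nonpos p2.le h)
      · exact le_max_of_le_right (Real.log_le_log p2 h)
    simp only [PiLp.neg_apply, Prod.fst_neg, Prod.snd_neg]
    grind
  rw [hz.1, hz.2.1] at h
  linarith

/-- Padé approximations make distinct solutions of the unit equation repel each other. -/
theorem logHeight_pade_le {p : ℕ} [Fact p.Prime] [Algebra (ZMod p) K]
    (hw : ∀ i, IsNonarchimedean (w i)) {K₀ : Subfield K}
    (hK₀ : ∀ z ∈ K₀, z ≠ 0 → ProductFormulaAt w z) {u u' : Kˣ × Kˣ}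
    (hu : (u.1 + u.2 : K) = 1) (hu' : (u'.1 + u'.2 : K) = 1) (huK : (u.1 : K) ∈ K₀)
    (huK' : (u'.1 : K) ∈ K₀)
    (hs : ∀ i ∉ s, w i u.1 = 1 ∧ w i u.2 = 1 ∧ w i u'.1 = 1 ∧ w i u'.2 = 1) {M d : ℕ}
    {P Q R : (ZMod p)[X]} (hP : P.natDegree ≤ d) (hQ : Q.natDegree ≤ d) (hR : R.natDegree ≤ d)
    (hrel : X ^ M * Q + (1 - X) ^ M * P = R)
    (hD : (u'.1 / u.1 ^ M : K) * aeval (u.1 : K) P - (u'.2 / u.2 ^ M : K) * aeval (u.1 : K) Q ≠ 0) :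
    M * logHeight s (logMap w s (.ofMul u)) ≤
      logHeight s (logMap w s (.ofMul u') - (M : ℝ) • logMap w s (.ofMul u)) +
        d * logHeight s (logMap w s (.ofMul u)) := by
  classical
  have e : logMap w s (.ofMul u') - (M : ℝ) • logMap w s (.ofMul u) =
      logMap w s (.ofMul (u' / u ^ M)) := by
    rw [ofMul_div, ofMul_pow, map_sub, map_nsmul, ← Nat.cast_smul_eq_nsmul ℝ]
  rw [e, logHeight_logMap, logHeight_logMap]
  have hx := u.1.ne_zero
  have hy := u.2.ne_zero
  set D := (u'.1 / u.1 ^ M : K) * aeval (u.1 : K) P - (u'.2 / u.2 ^ M : K) * aeval (u.1 : K) Q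
  have huK2 : (u.2 : K) ∈ K₀ := by
    rw [show (u.2 : K) = 1 - u.1 by rw [← hu]; ring]; exact sub_mem (one_mem _) huK
  have huK2' : (u'.2 : K) ∈ K₀ := by
    rw [show (u'.2 : K) = 1 - u'.1 by rw [← hu']; ring]; exact sub_mem (one_mem _) huK'
  have hpol (S : (ZMod p)[X]) : aeval (u.1 : K) S ∈ K₀ := by
    rw [aeval_eq_sum_range]
    refine sum_mem fun i _ => ?_
    obtain ⟨n, hn⟩ := ZMod.natCast_zmod_surjective (S.coeff i)
    rw [← hn, Algebra.smul_def, map_natCast]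
    exact mul_mem (natCast_mem _ _) (pow_mem huK _)
  have hDK : D ∈ K₀ := sub_mem (mul_mem (div_mem huK' (pow_mem huK _)) (hpol _))
    (mul_mem (div_mem huK2' (pow_mem huK2 _)) (hpol _))
  obtain ⟨s', hs', -⟩ := id (hK₀ D hDK hD)
  -- The logarithms of `D` sum to zero, so they can be inserted to reduce the claim to one place at
  -- a time.
  have hlog := (hK₀ D hDK hD).sum_log_eq_zero hD (S := s ∪ s')
    fun i hi => hs' i fun h => hi (Finset.mem_union_right _ h)
  have ext1 : ∑ i ∈ s, localHeight (w i) u.1 u.2 = ∑ i ∈ s ∪ s', localHeight (w i) u.1 u.2 :=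
    Finset.sum_subset Finset.subset_union_left fun i _ hi => by
      simp [localHeight, (hs i hi).1, (hs i hi).2.1]
  have ext2 : ∑ i ∈ s, localHeight (w i) (u' / u ^ M).1 (u' / u ^ M).2 =
      ∑ i ∈ s ∪ s', localHeight (w i) (u' / u ^ M).1 (u' / u ^ M).2 :=
    Finset.sum_subset Finset.subset_union_left fun i _ hi => by
      obtain ⟨a1, a2, a3, a4⟩ := hs i hi
      simp [localHeight, a1, a2, a3, a4]
  rw [ext1, ext2, Finset.mul_sum, Finset.mul_sum, ← Finset.sum_add_distrib, ← add_zero (∑ i ∈ _, _),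
    ← hlog, ← Finset.sum_add_distrib]
  refine Finset.sum_le_sum fun i _ => ?_
  refine localHeight_pade_le (p := p) (P := P) (Q := Q) (R := R) (hw i) hx hy (Units.ne_zero _)
    (Units.ne_zero _) hu ?_ hP hQ hR hrel ?_ |>.trans_eq' ?_
  · simp only [Prod.fst_div, Prod.snd_div, Prod.pow_fst, Prod.pow_snd, Units.val_div_eq_div_val,
      Units.val_pow_eq_pow_val]
    rw [div_mul_cancel₀ _ (pow_ne_zero _ hx), div_mul_cancel₀ _ (pow_ne_zero _ hy), hu']
  · simpa using hD
  · simp [D]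

/-- This is the approximation `X + (1 - X) = 1`; its determinant vanishes only for proportional,
hence equal, solutions. -/
theorem logHeight_le_sub {p : ℕ} [Fact p.Prime] [Algebra (ZMod p) K]
    (hw : ∀ i, IsNonarchimedean (w i)) {K₀ : Subfield K}
    (hK₀ : ∀ z ∈ K₀, z ≠ 0 → ProductFormulaAt w z) {u u' : Kˣ × Kˣ}
    (hu : (u.1 + u.2 : K) = 1) (hu' : (u'.1 + u'.2 : K) = 1) (huK : (u.1 : K) ∈ K₀)
    (huK' : (u'.1 : K) ∈ K₀)
    (hs : ∀ i ∉ s, w i u.1 = 1 ∧ w i u.2 = 1 ∧ w i u'.1 = 1 ∧ w i u'.2 = 1) (hne : u ≠ u') :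
    logHeight s (logMap w s (.ofMul u)) ≤
      logHeight s (logMap w s (.ofMul u') - logMap w s (.ofMul u)) := by
  have hx := u.1.ne_zero
  have hy := u.2.ne_zero
  have := logHeight_pade_le (p := p) (s := s) hw hK₀ hu hu' huK huK' hs (M := 1) (d := 0) (P := 1)
    (Q := 1) (R := 1) (by simp) (by simp) (by simp) (by ring) (by
      simp only [pow_one, map_one, mul_one]
      intro h
      rw [sub_eq_zero, div_eq_div_iff hx hy] at h
      have e1 : (u'.1 : K) = u.1 := by linear_combination h + u'.1 * hu.symm + u.1 * hu'
      have e2 : (u'.2 : K) = u.2 := by linear_combination hu' - hu - e1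
      exact hne (Prod.ext (Units.ext e1.symm) (Units.ext e2.symm)))
  simpa using this

/-- A transcendental `u.1` is not a root of the determinant of the Padé pair, so one of the two
approximants gives a nonzero value. -/
theorem mul_logHeight_le_sub {p : ℕ} [Fact p.Prime] [Algebra (ZMod p) K]
    (hw : ∀ i, IsNonarchimedean (w i)) {K₀ : Subfield K}
    (hK₀ : ∀ z ∈ K₀, z ≠ 0 → ProductFormulaAt w z) {u u' : Kˣ × Kˣ}
    (hu : (u.1 + u.2 : K) = 1) (hu' : (u'.1 + u'.2 : K) = 1) (huK : (u.1 : K) ∈ K₀)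
    (huK' : (u'.1 : K) ∈ K₀)
    (hs : ∀ i ∉ s, w i u.1 = 1 ∧ w i u.2 = 1 ∧ w i u'.1 = 1 ∧ w i u'.2 = 1)
    (htr : Transcendental (ZMod p) (u.1 : K)) {d : ℕ} (hd : 1 ≤ d) (hdp : 3 * d ≤ p) :
    d * logHeight s (logMap w s (.ofMul u)) ≤
      logHeight s (logMap w s (.ofMul u') - (2 * d : ℝ) • logMap w s (.ofMul u)) := by
  obtain ⟨P, Q, R, hPQR, hne⟩ := exists_pade_pair hd hdp
  have hD : ∃ i, (u'.1 / u.1 ^ (2 * d) : K) * aeval (u.1 : K) (P i) -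
      (u'.2 / u.2 ^ (2 * d) : K) * aeval (u.1 : K) (Q i) ≠ 0 := by
    by_contra! h
    refine htr ⟨_, hne, ?_⟩
    have hα : (u'.1 / u.1 ^ (2 * d) : K) ≠ 0 := by simp
    refine (mul_eq_zero.1 ?_).resolve_left hα
    have h0 := h 0
    have h1 := h 1
    simp only [map_sub, map_mul]
    linear_combination aeval (u.1 : K) (Q 0) * h1 - aeval (u.1 : K) (Q 1) * h0
  obtain ⟨i, hi⟩ := hD
  obtain ⟨h1, h2, h3, h4⟩ := hPQR i
  have := logHeight_pade_le (p := p) (s := s) hw hK₀ hu hu' huK huK' hs h1 h2 h3 h4 hi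
  push_cast at this
  linarith

end Places

/-! ### Construction of places with a product formula. -/

section ExistsPlaces
open Polynomial

universe u

section ProductFormula
variable {K : Type*} [Field K] {ι : Type*} {w : ι → AbsoluteValue K ℝ}

theorem ProductFormulaAt.one : ProductFormulaAt w 1 := ⟨∅, by simp, by simp⟩

theorem ProductFormulaAt.mul {z z' : K} (h : ProductFormulaAt w z) (h' : ProductFormulaAt w z') :
    ProductFormulaAt w (z * z') := by
  classical
  obtain ⟨s, hs, -⟩ := id h
  obtain ⟨s', hs', -⟩ := id h'
  have a : ∀ i ∉ s ∪ s', w i z = 1 := fun i hi => hs i fun h => hi (Finset.mem_union_left _ h)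
  have a' : ∀ i ∉ s ∪ s', w i z' = 1 := fun i hi => hs' i fun h => hi (Finset.mem_union_right _ h)
  refine ⟨s ∪ s', fun i hi => by rw [map_mul, a i hi, a' i hi, one_mul], ?_⟩
  simp_rw [map_mul]
  rw [Finset.prod_mul_distrib, h.prod_eq_one a, h'.prod_eq_one a', one_mul]

theorem ProductFormulaAt.inv {z : K} (h : ProductFormulaAt w z) : ProductFormulaAt w z⁻¹ := by
  obtain ⟨s, hs, hp⟩ := h
  exact ⟨s, fun i hi => by rw [map_inv₀, hs i hi, inv_one], by simp [Finset.prod_inv_distrib, hp]⟩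

theorem ProductFormulaAt.of_pow {z : K} {n : ℕ} (hn : n ≠ 0) (h : ProductFormulaAt w (z ^ n)) :
    ProductFormulaAt w z := by
  obtain ⟨s, hs, hp⟩ := h
  simp only [map_pow, Finset.prod_pow] at hs hp
  exact ⟨s, fun i hi => (pow_eq_one_iff_of_nonneg ((w i).nonneg _) hn).1 (hs i hi),
    (pow_eq_one_iff_of_nonneg (Finset.prod_nonneg fun i _ => (w i).nonneg _) hn).1 hp⟩

end ProductFormula

section Extension

theorem isUltrametricDist_completion {F : Type*} [Field F] {v : AbsoluteValue F ℝ}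
    (hv : IsNonarchimedean v) : IsUltrametricDist v.Completion := by
  refine IsUltrametricDist.isUltrametricDist_of_forall_norm_add_le_max_norm fun x y => ?_
  induction x, y using UniformSpace.Completion.induction_on₂ with
  | hp => exact isClosed_le (by fun_prop) (by fun_prop)
  | ih a b =>
    rw [← UniformSpace.Completion.coe_add]
    simp only [UniformSpace.Completion.norm_coe]
    exact hv a.ofAbs b.ofAbs

/-- A nonarchimedean absolute value extends to some algebraically closed field. -/
theorem exists_algClosed_extension {F : Type u} [Field F] {v : AbsoluteValue F ℝ}
    (hv : IsNonarchimedean v) (hnt : ∃ x, 1 < v x) :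
    ∃ (E : Type u) (_ : Field E) (_ : IsAlgClosed E) (_ : Algebra F E) (V : AbsoluteValue E ℝ),
      IsNonarchimedean V ∧ ∀ x, V (algebraMap F E x) = v x := by
  have := isUltrametricDist_completion hv
  let : NontriviallyNormedField v.Completion :=
    { (inferInstance : NormedField v.Completion) with
      non_trivial := by
        obtain ⟨x, hx⟩ := hnt
        exact ⟨((WithAbs.toAbs v x : WithAbs v) : v.Completion), by
          rw [UniformSpace.Completion.norm_coe]; exact hx⟩ }
  let E := AlgebraicClosure v.Completion
  -- Completeness of the base makes the spectral norm multiplicative.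
  let N := spectralMulAlgNorm v.Completion E
  let φ : F →+* E := (algebraMap v.Completion E).comp
    ((UniformSpace.Completion.coeRingHom (α := WithAbs v)).comp
      ((WithAbs.equiv v).symm : F →+* WithAbs v))
  refine ⟨E, inferInstance, inferInstance, φ.toAlgebra,
    { toFun := N
      map_mul' := map_mul N
      nonneg' := apply_nonneg N
      eq_zero' := fun x => map_eq_zero_iff_eq_zero N
      add_le' := map_add_le_add N }, ?_, ?_⟩
  · exact isNonarchimedean_spectralNorm (K := v.Completion) (L := E)
  · intro x
    refine (spectralNorm_extends (K := v.Completion) (L := E)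
      ((WithAbs.toAbs v x : WithAbs v) : v.Completion)).trans ?_
    rw [UniformSpace.Completion.norm_coe]
    rfl

variable {F Ω : Type u} [Field F] [Field Ω] [Algebra F Ω]

/-- A family of places with a product formula extends to finite extensions. -/
theorem exists_extension_places [Algebra.IsAlgebraic F Ω] {ι : Type u}
    {v : ι → AbsoluteValue F ℝ} (hv : ∀ i, IsNonarchimedean (v i)) (hnt : ∀ i, ∃ x, 1 < v i x)
    (hpf : ∀ z, z ≠ 0 → ProductFormulaAt v z) (L : IntermediateField F Ω) [FiniteDimensional F L]
    (q : ℕ) [ExpChar F q] :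
    ∃ (ι' : Type u) (w : ι' → AbsoluteValue Ω ℝ), (∀ i, IsNonarchimedean (w i)) ∧
      (∀ z ∈ L, z ≠ 0 → ProductFormulaAt w z) ∧
      ∀ i, ∃ i', ∀ z, w i' (algebraMap F Ω z) = v i z := by
  classical
  choose E hE hEc hEa V hV hVv using fun i => exists_algClosed_extension (hv i) (hnt i)
  -- The norm is a product over embeddings for the separable part; the rest of `L` is reached
  -- through `q ^ n`-th powers.
  let Ls := separableClosure F L
  have htower : IsScalarTower F Ls Ω := IsScalarTower.of_algebraMap_eq fun x => rfl
  have : Algebra.IsAlgebraic Ls Ω := Algebra.IsAlgebraic.tower_top (K := F) Ls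
  have hext (i : ι) (σ : Ls →ₐ[F] E i) : ∃ τ : Ω →ₐ[F] E i, ∀ z : Ls,
      τ (algebraMap Ls Ω z) = σ z := by
    obtain ⟨τ, hτ⟩ := IsAlgClosed.surjective_domRestrict_of_isAlgebraic (K := F) (L := Ls)
      (M := E i) (E := Ω) σ
    exact ⟨τ, fun z => DFunLike.congr_fun hτ z⟩
  choose τ hτ using hext
  -- Embeddings inducing the same absolute value are kept as separate indices, so that the product
  -- over `i` is the absolute value of the norm.
  let w : (Σ i, Ls →ₐ[F] E i) → AbsoluteValue Ω ℝ := fun j =>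
    (V j.1).comp (f := (τ j.1 j.2 : Ω →+* E j.1)) (RingHom.injective _)
  have hw (j) (z : Ω) : w j z = V j.1 (τ j.1 j.2 z) := rfl
  have hwF (j) (z : F) : w j (algebraMap F Ω z) = v j.1 z := by
    rw [hw, AlgHom.commutes, hVv]
  have hna (j) : IsNonarchimedean (w j) := fun x y => by
    simp only [hw, map_add]; exact hV _ _ _
  -- integrality outside a finite set of places
  have hint (z : Ω) : ∃ S : Finset ι, ∀ j, j.1 ∉ S → w j z ≤ 1 := by
    have hz : IsIntegral F z := (Algebra.IsAlgebraic.isAlgebraic z).isIntegral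
    have hc (n : ℕ) : ∃ s : Finset ι, ∀ i ∉ s, v i ((minpoly F z).coeff n) ≤ 1 := by
      by_cases h0 : (minpoly F z).coeff n = 0
      · exact ⟨∅, fun i _ => by simp [h0]⟩
      · obtain ⟨s, hs, -⟩ := hpf _ h0
        exact ⟨s, fun i hi => (hs i hi).le⟩
    choose s hs using hc
    refine ⟨(Finset.range ((minpoly F z).natDegree + 1)).biUnion s, fun j hj => ?_⟩
    refine (hna j).abv_le_one_of_monic (P := (minpoly F z).map (algebraMap F Ω))
      ((minpoly.monic hz).map _) (fun n => ?_)
      (by rw [eval_map_algebraMap]; exact minpoly.aeval _ _)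
    rw [coeff_map, hwF]
    rcases lt_or_ge n ((minpoly F z).natDegree + 1) with hn | hn
    · exact hs n _ fun h => hj (Finset.mem_biUnion.2 ⟨n, Finset.mem_range.2 hn, h⟩)
    · rw [coeff_eq_zero_of_natDegree_lt (by lia)]; simp
  have hpfs (z : Ls) (hz : z ≠ 0) : ProductFormulaAt w (algebraMap Ls Ω z) := by
    have hz' : algebraMap Ls Ω z ≠ 0 := by simpa using hz
    obtain ⟨S₁, hS₁⟩ := hint (algebraMap Ls Ω z)
    obtain ⟨S₂, hS₂⟩ := hint (algebraMap Ls Ω z)⁻¹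
    have hN := hpf (Algebra.norm F z) (by simpa using hz)
    obtain ⟨S₃, hS₃, -⟩ := id hN
    refine ⟨(S₁ ∪ S₂ ∪ S₃).sigma fun _ => Finset.univ, fun j hj => ?_, ?_⟩
    · have hj' : j.1 ∉ S₁ ∧ j.1 ∉ S₂ := by
        simp only [Finset.mem_sigma, Finset.mem_union, Finset.mem_univ, and_true] at hj
        tauto
      have h2 := hS₂ j hj'.2
      rw [map_inv₀] at h2
      exact le_antisymm (hS₁ j hj'.1) ((inv_le_one₀ ((w j).pos hz')).1 h2)
    · rw [Finset.prod_sigma, ← hN.prod_eq_one (S := S₁ ∪ S₂ ∪ S₃)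
        fun i hi => hS₃ i fun h => hi (Finset.mem_union_right _ h)]
      refine Finset.prod_congr rfl fun i _ => ?_
      rw [← hVv, Algebra.norm_eq_prod_embeddings F (E i) z, map_prod]
      exact Finset.prod_congr rfl fun σ _ => by rw [hw, hτ]
  refine ⟨_, w, hna, fun z hz hz0 => ?_, fun i => ?_⟩
  · obtain ⟨n, y, hy⟩ := IsPurelyInseparable.pow_mem Ls q (⟨z, hz⟩ : L)
    have hyz : algebraMap Ls Ω y = z ^ q ^ n := congrArg (algebraMap L Ω) hy
    refine ProductFormulaAt.of_pow (n := q ^ n) (pow_ne_zero _ (expChar_pos F q).ne') ?_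
    rw [← hyz]
    refine hpfs y fun h0 => ?_
    rw [h0, map_zero] at hyz
    exact pow_ne_zero _ hz0 hyz.symm
  · exact ⟨⟨i, IsAlgClosed.lift⟩, fun z => hwF _ z⟩

end Extension

section RationalFunctions
variable (k : Type u) [Field k]

open scoped Classical in
/-- The place at infinity of the field of rational functions. -/
noncomputable def ratFuncInfinityAbv : AbsoluteValue (RatFunc k) ℝ where
  toFun z := if z = 0 then 0 else 2 ^ z.intDegree
  map_mul' x y := by
    by_cases hx : x = 0
    · simp [hx]
    by_cases hy : y = 0
    · simp [hy]
    simp [hx, hy, RatFunc.intDegree_mul, zpow_add₀]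
  nonneg' x := by split_ifs <;> positivity
  eq_zero' x := by
    split_ifs with h
    · simp [h]
    · simp [h, zpow_ne_zero]
  add_le' x y := by
    by_cases hx : x = 0
    · simp [hx]
    by_cases hy : y = 0
    · simp [hy]
    rw [if_neg hx, if_neg hy]
    split_ifs with h
    · positivity
    · have := zpow_le_zpow_right₀ (one_le_two (α := ℝ)) (RatFunc.intDegree_add_le hy h)
      rcases max_choice x.intDegree y.intDegree with hm | hm <;> rw [hm] at this
      · exact this.trans (le_add_of_nonneg_right (by positivity))
      · exact this.trans (le_add_of_nonneg_left (by positivity))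

variable {k}

theorem ratFuncInfinityAbv_apply {z : RatFunc k} (hz : z ≠ 0) :
    ratFuncInfinityAbv k z = 2 ^ z.intDegree := if_neg hz

theorem isNonarchimedean_ratFuncInfinityAbv : IsNonarchimedean (ratFuncInfinityAbv k) := by
  intro x y
  by_cases hx : x = 0
  · simp [hx]
  by_cases hy : y = 0
  · simp [hy]
  by_cases h : x + y = 0
  · simp [h]
  rw [ratFuncInfinityAbv_apply hx, ratFuncInfinityAbv_apply hy, ratFuncInfinityAbv_apply h]
  have := zpow_le_zpow_right₀ (one_le_two (α := ℝ)) (RatFunc.intDegree_add_le hy h)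
  rcases max_choice x.intDegree y.intDegree with hm | hm <;> rw [hm] at this
  · exact le_max_of_le_left this
  · exact le_max_of_le_right this

open IsDedekindDomain in
/-- The prime of `k[X]` corresponding to the point `a`. -/
noncomputable def pointPrime (a : k) : HeightOneSpectrum k[X] where
  asIdeal := Ideal.span {X - C a}
  isPrime := (Ideal.span_singleton_prime (X_sub_C_ne_zero a)).2 (prime_X_sub_C a)
  ne_bot := by simpa using X_sub_C_ne_zero a

/-- The place of the field of rational functions at the point `a`. -/
noncomputable def ratFuncPointAbv (a : k) : AbsoluteValue (RatFunc k) ℝ :=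
  (pointPrime a).adicAbv (b := 2) one_lt_two

theorem ratFuncPointAbv_eq_one {a : k} {f : k[X]} (hf : f.eval a ≠ 0) :
    ratFuncPointAbv a (algebraMap k[X] (RatFunc k) f) = 1 := by
  rw [ratFuncPointAbv, IsDedekindDomain.HeightOneSpectrum.adicAbv_coe_eq_one_iff]
  rw [pointPrime, Ideal.mem_span_singleton, dvd_iff_isRoot]
  exact hf

theorem ratFuncPointAbv_X_sub_C (a : k) :
    ratFuncPointAbv a (algebraMap k[X] (RatFunc k) (X - C a)) = 2⁻¹ := by
  have h : WithZeroMulInt.toNNReal (ne_zero_of_lt (one_lt_two (α := NNReal)))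
      (WithZero.exp (-1 : ℤ)) = 2⁻¹ := by
    rw [WithZeroMulInt.toNNReal_neg_apply _ WithZero.exp_ne_zero]
    exact zpow_neg_one (2 : NNReal)
  rw [ratFuncPointAbv, IsDedekindDomain.HeightOneSpectrum.adicAbv_of_algebraMap]
  have h' : (pointPrime a).intAdicAbv (one_lt_two (α := NNReal)) (X - C a) =
      (WithZeroMulInt.toNNReal (ne_zero_of_lt (one_lt_two (α := NNReal)))
        ((pointPrime a).intValuation (X - C a)) : ℝ) := rfl
  rw [h', (pointPrime a).intValuation_singleton (X_sub_C_ne_zero a) rfl, h]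
  simp

/-- The places of the field of rational functions over an algebraically closed field. -/
noncomputable def ratFuncPlace : Option k → AbsoluteValue (RatFunc k) ℝ
  | none => ratFuncInfinityAbv k
  | some a => ratFuncPointAbv a

/-- Every polynomial splits, so it suffices to treat constants and `X - a`; the latter has value `2`
at infinity, `1 / 2` at `a`, and `1` elsewhere. -/
theorem productFormulaAt_ratFuncPlace [IsAlgClosed k] {z : RatFunc k} (hz : z ≠ 0) :
    ProductFormulaAt ratFuncPlace z := by
  classical
  have hinj := RatFunc.algebraMap_injective k
  have hpol (f : k[X]) (hf : f ≠ 0) :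
      ProductFormulaAt ratFuncPlace (algebraMap k[X] (RatFunc k) f) := by
    rw [(IsAlgClosed.splits f).eq_prod_roots, map_mul]
    refine ProductFormulaAt.mul ?_ ?_
    · have hc := leadingCoeff_ne_zero.2 hf
      refine ⟨∅, fun i _ => ?_, by simp⟩
      rcases i with _ | a
      · rw [ratFuncPlace, ratFuncInfinityAbv_apply (by simpa using hf),
          RatFunc.intDegree_polynomial]
        simp
      · exact ratFuncPointAbv_eq_one (by simpa using hf)
    · rw [map_multiset_prod, Multiset.map_map]
      refine Multiset.prod_induction (ProductFormulaAt ratFuncPlace) _ (fun _ _ h h' => h.mul h')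
        .one fun y hy => ?_
      obtain ⟨a, -, rfl⟩ := Multiset.mem_map.1 hy
      have h0 : ratFuncPlace none (algebraMap k[X] (RatFunc k) (X - C a)) = 2 := by
        rw [ratFuncPlace, ratFuncInfinityAbv_apply (by
          rw [map_ne_zero_iff _ hinj]; exact X_sub_C_ne_zero a), RatFunc.intDegree_polynomial]
        simp
      refine ⟨{none, some a}, fun i hi => ?_, ?_⟩
      · rcases i with _ | b
        · simp at hi
        · refine ratFuncPointAbv_eq_one ?_
          simp only [Finset.mem_insert, Finset.mem_singleton, not_or, Option.some.injEq] at hi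
          simpa [sub_eq_zero] using hi.2
      · rw [Finset.prod_pair (by simp)]
        simp only [Function.comp_apply]
        rw [h0, ratFuncPlace, ratFuncPointAbv_X_sub_C]
        norm_num
  rw [← RatFunc.num_div_denom z, div_eq_mul_inv]
  exact (hpol _ (RatFunc.num_ne_zero hz)).mul (hpol _ (RatFunc.denom_ne_zero z)).inv

theorem isNonarchimedean_ratFuncPlace (i : Option k) : IsNonarchimedean (ratFuncPlace i) := by
  rcases i with _ | a
  · exact isNonarchimedean_ratFuncInfinityAbv
  · exact IsDedekindDomain.HeightOneSpectrum.isNonarchimedean_adicAbv _ _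

theorem one_lt_ratFuncInfinityAbv_X : 1 < ratFuncPlace none (RatFunc.X : RatFunc k) := by
  rw [ratFuncPlace, ratFuncInfinityAbv_apply RatFunc.X_ne_zero, RatFunc.intDegree_X]
  norm_num

theorem exists_one_lt_ratFuncPlace (i : Option k) : ∃ x, 1 < ratFuncPlace i x := by
  rcases i with _ | a
  · exact ⟨_, one_lt_ratFuncInfinityAbv_X⟩
  · refine ⟨(algebraMap k[X] (RatFunc k) (X - C a))⁻¹, ?_⟩
    rw [ratFuncPlace, map_inv₀, ratFuncPointAbv_X_sub_C]
    norm_num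

end RationalFunctions

/-- A transcendental element of an algebraically closed field is a variable over an algebraically
closed subfield. -/
theorem exists_algClosed_subfield {F Ω : Type*} [Field F] [Field Ω] [Algebra F Ω] [IsAlgClosed Ω]
    {x : Ω} (hx : Transcendental F x) : ∃ k : IntermediateField F Ω, IsAlgClosed k ∧
      Transcendental k x ∧ ∃ B : Set Ω, IsTranscendenceBasis F ((↑) : B → Ω) ∧
        ∀ y ∈ B, y = x ∨ y ∈ k := by
  have hx' : AlgebraicIndepOn F id {x} := 
    (algebraicIndependent_singleton_iff (ι := ({x} : Set Ω)) (x := fun i => id (i : Ω)) ⟨x, rfl⟩).2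
      hx
  -- The basis elements other than `x` are absorbed into `k`.
  obtain ⟨B, hxB, hB⟩ := exists_isTranscendenceBasis_superset hx'
  have hxB : x ∈ B := hxB rfl
  set s : Set Ω := ((↑) : B → Ω) '' {⟨x, hxB⟩}ᶜ with hs
  have h0 : (⟨x, hxB⟩ : B) ∉ ({⟨x, hxB⟩}ᶜ : Set B) := fun h => h rfl
  have h1 : Transcendental (Algebra.adjoin F s) x := hB.1.transcendental_adjoin h0
  have h2 : Transcendental (IntermediateField.adjoin F s) x := by
    intro h
    open scoped IntermediateField.algebraAdjoinAdjoin in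
    exact h1
      ((IsFractionRing.isAlgebraic_iff (Algebra.adjoin F s) (IntermediateField.adjoin F s) Ω).2 h)
  let k := algebraicClosure (IntermediateField.adjoin F s) Ω
  have hk : IsAlgClosed k := IsAlgClosure.isAlgClosed (IntermediateField.adjoin F s)
  refine ⟨k.restrictScalars F, hk, h2.algebraicClosure, B, hB, fun y hy => ?_⟩
  by_cases hyx : y = x
  · exact .inl hyx
  · refine .inr ?_
    have : y ∈ IntermediateField.adjoin F s :=
      IntermediateField.subset_adjoin F s ⟨⟨y, hy⟩, fun h => hyx (congrArg Subtype.val h), rfl⟩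
    exact k.algebraMap_mem ⟨y, this⟩

end ExistsPlaces

section ExistsPlaces
open Polynomial

universe u

/-- Every transcendental element is large at some place of a family that satisfies the product
formula on a given finite set. -/
theorem exists_places_of_transcendental {K : Type u} [Field K] {p : ℕ} [Fact p.Prime]
    [Algebra (ZMod p) K] {x : K} (hx : Transcendental (ZMod p) x) (T : Finset K) :
    ∃ (ι : Type u) (w : ι → AbsoluteValue K ℝ) (K₀ : Subfield K), (∀ i, IsNonarchimedean (w i)) ∧
      (T : Set K) ⊆ K₀ ∧ (∀ z ∈ K₀, z ≠ 0 → ProductFormulaAt w z) ∧ ∃ i, 1 < w i x := by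
  let Ω := AlgebraicClosure K
  have hx' : Transcendental (ZMod p) (algebraMap K Ω x) :=
    (transcendental_algebraMap_iff (algebraMap K Ω).injective).2 hx
  -- The closure `Ω` is algebraic over `k(x)`, where `x` has a pole at infinity.
  obtain ⟨k, hk, hkx, B, hB, hBk⟩ := exists_algClosed_subfield hx'
  have hinj : Function.Injective (aeval (algebraMap K Ω x) : k[X] →ₐ[k] Ω) :=
    transcendental_iff_injective.1 hkx
  let φ : RatFunc k →ₐ[k] Ω := RatFunc.liftAlgHom (aeval (algebraMap K Ω x))
    (nonZeroDivisors_le_comap_nonZeroDivisors_of_injective _ hinj)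
  let : Algebra (RatFunc k) Ω := φ.toRingHom.toAlgebra
  have hφX : algebraMap (RatFunc k) Ω RatFunc.X = algebraMap K Ω x := by
    have := RatFunc.liftAlgHom_apply_div (aeval (algebraMap K Ω x) : k[X] →ₐ[k] Ω)
      (nonZeroDivisors_le_comap_nonZeroDivisors_of_injective _ hinj) X 1
    simp only [RatFunc.algebraMap_X, map_one, div_one, aeval_X] at this
    exact this
  have : IsScalarTower (ZMod p) (RatFunc k) Ω :=
    IsScalarTower.of_algebraMap_eq' (Subsingleton.elim _ _)
  have halg : Algebra.IsAlgebraic (RatFunc k) Ω := by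
    rw [hB.isAlgebraic_iff]
    rintro ⟨y, hy⟩
    rcases hBk y hy with rfl | hyk
    · change IsAlgebraic (RatFunc k) (algebraMap K Ω x)
      rw [← hφX]
      exact isAlgebraic_algebraMap _
    · have : algebraMap (RatFunc k) Ω (algebraMap k (RatFunc k) ⟨y, hyk⟩) = y :=
        φ.commutes ⟨y, hyk⟩
      change IsAlgebraic (RatFunc k) y
      rw [← this]
      exact isAlgebraic_algebraMap _
  have : CharP (RatFunc k) p := charP_of_injective_algebraMap (algebraMap (ZMod p) _).injective p
  have : ExpChar (RatFunc k) p := ExpChar.prime Fact.out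
  let L := IntermediateField.adjoin (RatFunc k) (algebraMap K Ω '' T)
  have : Finite (algebraMap K Ω '' T) := (T.finite_toSet.image _).to_subtype
  have : FiniteDimensional (RatFunc k) L :=
    IntermediateField.finiteDimensional_adjoin fun y _ => (halg.isAlgebraic y).isIntegral
  obtain ⟨ι, w, hw, hpf, hext⟩ := exists_extension_places (Ω := Ω) isNonarchimedean_ratFuncPlace
    (exists_one_lt_ratFuncPlace (k := k)) (fun z hz => productFormulaAt_ratFuncPlace hz) L p
  refine ⟨ι, fun i => (w i).comp (algebraMap K Ω).injective, L.toSubfield.comap (algebraMap K Ω),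
    fun i y z => ?_, fun y hy => ?_, fun z hz hz0 => ?_, ?_⟩
  · have := hw i (algebraMap K Ω y) (algebraMap K Ω z)
    rw [← map_add] at this
    exact this
  · exact IntermediateField.subset_adjoin _ _ ⟨y, hy, rfl⟩
  · exact hpf (algebraMap K Ω z) hz (by simpa using hz0)
  · obtain ⟨i, hi⟩ := hext none
    refine ⟨i, ?_⟩
    have := hi RatFunc.X
    rw [hφX] at this
    exact one_lt_ratFuncInfinityAbv_X.trans_eq this.symm

/-- A finite set of transcendental elements admits a family of places satisfying the product formula
such that each of these elements is large somewhere. -/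
theorem exists_places {K : Type u} [Field K] {p : ℕ} [Fact p.Prime] [Algebra (ZMod p) K]
    (T : Finset K) (hT : ∀ x ∈ T, Transcendental (ZMod p) x) :
    ∃ (ι : Type u) (w : ι → AbsoluteValue K ℝ) (K₀ : Subfield K), (∀ i, IsNonarchimedean (w i)) ∧
      (T : Set K) ⊆ K₀ ∧ (∀ z ∈ K₀, z ≠ 0 → ProductFormulaAt w z) ∧ ∀ x ∈ T, ∃ i, 1 < w i x := by
  choose ι w K₀ hw hTK hpf hbig using
    fun x : T => exists_places_of_transcendental (hT x.1 x.2) T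
  -- The families for the individual `x` are juxtaposed; each keeps its product formula on the
  -- intersection of the subfields.
  refine ⟨Σ x : T, ι x, fun j => w j.1 j.2, ⨅ x, K₀ x, fun j => hw _ _, fun y hy => ?_,
    fun z hz hz0 => ?_, fun x hx => ?_⟩
  · simp only [Subfield.coe_iInf, Set.mem_iInter]
    exact fun x => hTK x hy
  · choose s hs hp using fun x => hpf x z ((Subfield.mem_iInf.1 hz) x) hz0
    refine ⟨Finset.univ.sigma s, fun j hj => hs _ _ fun h => hj (by simp [h]), ?_⟩
    rw [Finset.prod_sigma]
    exact Finset.prod_eq_one fun x _ => hp x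
  · obtain ⟨i, hi⟩ := hbig ⟨x, hx⟩
    exact ⟨⟨⟨x, hx⟩, i⟩, hi⟩

end ExistsPlaces

/-! ### Rank, Frobenius and the count of solutions. -/

section UnitEquation

/-- The real span of the image of an abelian group has dimension at most its rational rank. -/
theorem finrank_span_range_le_of_rank_eq {A : Type*} [AddCommGroup A] {r : ℕ}
    (hr : Module.rank ℚ (ℚ ⊗[ℤ] A) = r) {E : Type*} [AddCommGroup E] [Module ℝ E] (f : A →+ E) :
    Module.finrank ℝ (Submodule.span ℝ (Set.range f)) ≤ r := by
  let : Module ℚ E := Module.compHom E (algebraMap ℚ ℝ)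
  have : IsScalarTower ℚ ℝ E := ⟨fun c x e => by
    rw [Algebra.smul_def, mul_smul]; rfl⟩
  have hfin : Module.Finite ℚ (ℚ ⊗[ℤ] A) :=
    Module.rank_lt_aleph0_iff.1 (hr ▸ Cardinal.natCast_lt_aleph0)
  let b := Module.finBasisOfFinrankEq ℚ (ℚ ⊗[ℤ] A) (Module.finrank_eq_of_rank_eq hr)
  let g : ℚ ⊗[ℤ] A →ₗ[ℚ] E := f.toIntLinearMap.liftBaseChange ℚ
  have hle : Submodule.span ℝ (Set.range f) ≤ Submodule.span ℝ (Set.range fun i => g (b i)) := by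
    rw [Submodule.span_le]
    rintro _ ⟨x, rfl⟩
    have hx : f x = g (1 ⊗ₜ x) := by simp [g]
    rw [hx, ← b.sum_repr (1 ⊗ₜ x), map_sum]
    refine sum_mem fun i _ => ?_
    rw [map_smul, ← algebraMap_smul ℝ]
    exact Submodule.smul_mem _ _ (Submodule.subset_span ⟨i, rfl⟩)
  have : Module.Finite ℝ (Submodule.span ℝ (Set.range fun i => g (b i))) :=
    Module.Finite.span_of_finite ℝ (Set.finite_range _)
  refine (Submodule.finrank_mono hle).trans ?_
  exact (finrank_range_le_card (R := ℝ) fun i => g (b i)).trans_eq (by simp)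

variable {K : Type*} [Field K]

theorem frobenius_solution {p : ℕ} [Fact p.Prime] [CharP K p] {u : Kˣ × Kˣ}
    (hu : (u.1 + u.2 : K) = 1) (n : ℕ) :
    (((u ^ p ^ n).1 : Kˣ) + ((u ^ p ^ n).2 : Kˣ) : K) = 1 := by
  simp only [Prod.pow_fst, Prod.pow_snd, Units.val_pow_eq_pow_val]
  rw [← add_pow_char_pow, hu, one_pow]

/-- The solutions of the unit equation that are pairwise inequivalent under Frobenius are few. -/
theorem card_solutions_le {p : ℕ} [Fact p.Prime] [CharP K p] [Algebra (ZMod p) K] {ι : Type*}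
    {w : ι → AbsoluteValue K ℝ} (hw : ∀ i, IsNonarchimedean (w i)) {K₀ : Subfield K}
    (hK₀ : ∀ z ∈ K₀, z ≠ 0 → ProductFormulaAt w z) (T : Finset (Kˣ × Kˣ))
    (hT : ∀ u ∈ T, (u.1 + u.2 : K) = 1) (hTK : ∀ u ∈ T, (u.1 : K) ∈ K₀)
    (hbig : ∀ u ∈ T, ∃ i, 1 < w i u.1)
    (hfrob : ∀ u ∈ T, ∀ u' ∈ T, u ≠ u' → ∀ n : ℕ, u ^ p ^ n ≠ u') {R : ℕ}
    (hR : ∀ s : Finset ι, Module.finrank ℝ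
      (Submodule.span ℝ ((fun u => logMap w s (.ofMul u)) '' (T : Set (Kˣ × Kˣ)))) ≤ R) :
    T.card ≤ 2 * 19 ^ R := by
  classical
  have hTK2 : ∀ u ∈ T, (u.2 : K) ∈ K₀ := fun u hu => by
    rw [show (u.2 : K) = 1 - u.1 by rw [← hT u hu]; ring]; exact sub_mem (one_mem _) (hTK u hu)
  have hsupp (u) (hu : u ∈ T) : ∃ s : Finset ι, ∀ i ∉ s, w i u.1 = 1 ∧ w i u.2 = 1 := by
    obtain ⟨s, hs, -⟩ := hK₀ _ (hTK u hu) u.1.ne_zero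
    obtain ⟨s', hs', -⟩ := hK₀ _ (hTK2 u hu) u.2.ne_zero
    exact ⟨s ∪ s', fun i hi => ⟨hs i fun h => hi (Finset.mem_union_left _ h),
      hs' i fun h => hi (Finset.mem_union_right _ h)⟩⟩
  choose! S hS using hsupp
  set s := T.biUnion S
  have hs (u) (hu : u ∈ T) (i) (hi : i ∉ s) : w i u.1 = 1 ∧ w i u.2 = 1 :=
    hS u hu i fun h => hi (Finset.mem_biUnion.2 ⟨u, hu, h⟩)
  set φ : Kˣ × Kˣ → LogSpace s := fun u => logMap w s (.ofMul u) with hφ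
  set W := Submodule.span ℝ (φ '' (T : Set (Kˣ × Kˣ))) with hW
  have hφZ (u) (hu : u ∈ T) : φ u ∈ productFormulaSpace s :=
    logMap_mem_productFormulaSpace (hK₀ _ (hTK u hu) u.1.ne_zero) (hK₀ _ (hTK2 u hu) u.2.ne_zero)
      (fun i hi => (hs u hu i hi).1) (fun i hi => (hs u hu i hi).2)
  have hWZ : W ≤ productFormulaSpace s := by
    rw [hW, Submodule.span_le]
    rintro _ ⟨u, hu, rfl⟩
    exact hφZ u hu
  have hφW (u : T) : φ u ∈ W := Submodule.subset_span ⟨u, u.2, rfl⟩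
  have hφp (u : Kˣ × Kˣ) (n : ℕ) : φ (u ^ p ^ n) = (p : ℝ) ^ n • φ u := by
    simp only [hφ]
    rw [ofMul_pow, map_nsmul, ← Nat.cast_smul_eq_nsmul ℝ]
    push_cast; rfl
  have hh := isSublinear_logHeight s
  have hp0 : (0 : ℝ) < p := by exact_mod_cast (Fact.out : p.Prime).pos
  have hsp (u) (hu : u ∈ T) (u') (hu' : u' ∈ T) (n n' : ℕ) (i) (hi : i ∉ s) :
      w i (u ^ p ^ n).1 = 1 ∧ w i (u ^ p ^ n).2 = 1 ∧ w i (u' ^ p ^ n').1 = 1 ∧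
        w i (u' ^ p ^ n').2 = 1 := by
    simp [hs u hu i hi, hs u' hu' i hi]
  have hKp (u) (hu : u ∈ T) (n : ℕ) : ((u ^ p ^ n).1 : K) ∈ K₀ := by
    simpa using pow_mem (hTK u hu) _
  -- passage from Frobenius twists to all integral powers of `p`
  have twist (u) (u') (m c : ℝ)
      (H : ∀ n n' : ℕ, n = 0 ∨ n' = 0 → c * logHeight s (φ (u ^ p ^ n)) ≤
        logHeight s (φ (u' ^ p ^ n') - m • φ (u ^ p ^ n))) (k : ℤ) :
      c * logHeight s (φ u) ≤ logHeight s ((p : ℝ) ^ k • φ u' - m • φ u) := by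
    rcases Int.eq_nat_or_neg k with ⟨n, rfl | rfl⟩
    · simpa [hφp] using H 0 n (.inl rfl)
    -- For a negative exponent Frobenius acts on `u` instead, and homogeneity removes the factor `p
    -- ^ n`.
    · have h := H n 0 (.inr rfl)
      have hpn : (0 : ℝ) < (p : ℝ) ^ n := pow_pos hp0 n
      have e : φ (u' ^ p ^ 0) - m • φ (u ^ p ^ n) =
          (p : ℝ) ^ n • ((p : ℝ) ^ (-(n : ℤ)) • φ u' - m • φ u) := by
        rw [hφp, hφp, smul_sub, zpow_neg, zpow_natCast, smul_inv_smul₀ hpn.ne', smul_comm m,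
          pow_zero, one_smul]
      rw [e, hh.smul _ _ hpn.le, hφp, hh.smul _ _ hpn.le] at h
      exact le_of_mul_le_mul_left (by linarith) hpn
  have hmain := card_le_of_repelling (E := W) (Fact.out : p.Prime).two_le
    (h := fun z => logHeight s (z : LogSpace s)) ⟨fun x y => hh.add_le _ _, fun c x => hh.smul c _⟩
    (fun z => logHeight_le_norm (hWZ z.2)) (Finset.univ : Finset T) (fun u => ⟨φ u, hφW u⟩)
    (fun u _ => ?_) (fun u _ => ?_) (fun u _ => ?_) (fun u _ u' _ hne k => ?_)
    (fun u _ u' _ k d hd hdp => ?_)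
  · rw [Finset.card_univ, Fintype.card_coe] at hmain
    exact hmain.trans (Nat.mul_le_mul_left 2 (Nat.pow_le_pow_right (by norm_num) (hR s)))
  · obtain ⟨i, hi⟩ := hbig u u.2
    have his : i ∈ s := by
      by_contra h
      rw [(hs u u.2 i h).1] at hi
      exact lt_irrefl _ hi
    change 0 < logHeight s (logMap w s (.ofMul u.1))
    rw [logHeight_logMap]
    exact Finset.sum_pos' (fun i _ => le_max_left _ _)
      ⟨i, his, lt_max_of_lt_right (lt_max_of_lt_left (Real.log_pos hi))⟩
  · change ‖φ u‖ = 3 * logHeight s (φ u)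
    rw [norm_eq_logHeight_add (hφZ u u.2), logHeight_neg_logMap hw (hT u u.2) (hφZ u u.2)]
    ring
  · exact logHeight_neg_logMap hw (hT u u.2) (hφZ u u.2)
  · have hne' : u.1 ≠ u'.1 := fun h => hne (Subtype.ext h)
    have := twist u u' 1 1 (fun n n' hn => by
      rw [one_mul, one_smul]
      refine logHeight_le_sub (p := p) hw hK₀ (frobenius_solution (hT u u.2) n)
        (frobenius_solution (hT u' u'.2) n') (hKp u u.2 n) (hKp u' u'.2 n')
        (hsp u u.2 u' u'.2 n n') ?_
      rcases hn with rfl | rfl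
      · rw [pow_zero, pow_one]
        exact (hfrob u' u'.2 u u.2 hne'.symm n').symm
      · rw [pow_zero, pow_one]
        exact hfrob u u.2 u' u'.2 hne' n) k
    rw [one_mul, one_smul] at this
    exact this
  -- Distinctness plays no role here: transcendence of the twisted coordinate is enough.
  · refine twist u u' (2 * d) d (fun n n' _ => ?_) k
    refine mul_logHeight_le_sub (p := p) hw hK₀ (frobenius_solution (hT u u.2) n)
      (frobenius_solution (hT u' u'.2) n') (hKp u u.2 n) (hKp u' u'.2 n')
      (hsp u u.2 u' u'.2 n n') ?_ hd hdp
    obtain ⟨i, hi⟩ := hbig u u.2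
    refine (hw i).transcendental_of_one_lt ?_
    simpa using one_lt_pow₀ hi (pow_ne_zero n (Fact.out : p.Prime).ne_zero)

/-- Solutions of the unit equation with algebraic coordinates are torsion of order prime to `p`. -/
theorem exists_pow_eq_one_of_isAlgebraic {p : ℕ} [Fact p.Prime] [Algebra (ZMod p) K]
    {u : Kˣ × Kˣ} (hu : (u.1 + u.2 : K) = 1) (hal : IsAlgebraic (ZMod p) (u.1 : K)) :
    ∃ n, 1 ≤ n ∧ n.Coprime p ∧ u ^ n = 1 := by
  have hp := (Fact.out : p.Prime)
  -- Both coordinates lie in a finite field, whose multiplicative group has order `-1` mod `p`.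
  let L := IntermediateField.adjoin (ZMod p) {(u.1 : K)}
  have : FiniteDimensional (ZMod p) L := IntermediateField.adjoin.finiteDimensional hal.isIntegral
  have : Finite L := Module.finite_of_finite (ZMod p)
  let : Fintype L := Fintype.ofFinite L
  have hcard : Fintype.card L = p ^ Module.finrank (ZMod p) L := by
    rw [Module.card_eq_pow_finrank (K := ZMod p), ZMod.card]
  have hpos : Module.finrank (ZMod p) L ≠ 0 := Module.finrank_pos.ne'
  have hpow (x : Kˣ) (hx : (x : K) ∈ L) : x ^ (Fintype.card L - 1) = 1 := by
    have := FiniteField.pow_card_sub_one_eq_one (⟨x, hx⟩ : L) (by simp [Subtype.ext_iff])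
    ext
    simpa using congrArg (algebraMap L K) this
  have h1 : (u.1 : K) ∈ L := IntermediateField.mem_adjoin_simple_self _ _
  have h2 : (u.2 : K) ∈ L := by
    rw [show (u.2 : K) = 1 - u.1 by rw [← hu]; ring]; exact sub_mem (one_mem _) h1
  have hone : 1 < Fintype.card L := Fintype.one_lt_card
  refine ⟨Fintype.card L - 1, by lia, ?_, Prod.ext (hpow _ h1) (hpow _ h2)⟩
  rw [Nat.coprime_comm, hp.coprime_iff_not_dvd]
  intro h
  have hd : p ∣ Fintype.card L := hcard ▸ dvd_pow_self p hpos
  have h' := (Nat.dvd_sub_iff_right hone.le hd).1 h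
  exact hp.one_lt.ne' (Nat.dvd_one.1 h')

end UnitEquation

theorem theorem1p1 {K : Type*} [Field K] (p : ℕ) (hp : p.Prime) [CharP K p]
    (G : Subgroup (Kˣ × Kˣ)) (r : ℕ)
    (hr : Module.rank ℚ (ℚ ⊗[ℤ] Additive G) = r) (a b : Kˣ)
    (hab : ¬ ∃ n : ℕ, 1 ≤ n ∧ n.Coprime p ∧ (a, b) ^ n ∈ G) :
    {u : Kˣ × Kˣ | u ∈ G ∧ (a : K) * (u.1 : K) + (b : K) * (u.2 : K) = 1}.encard
      ≤ 31 * 19 ^ (r + 1) := by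
  classical
  have : Fact p.Prime := ⟨hp⟩
  let := ZMod.algebra K p
  by_contra! hlt
  -- Finiteness of the solution set is not known beforehand, and places are available only for
  -- finite sets.
  obtain ⟨t, hts, htcard⟩ := Set.exists_subset_encard_eq (Order.add_one_le_of_lt hlt)
  have htfin : t.Finite := Set.finite_of_encard_eq_coe (k := 31 * 19 ^ (r + 1) + 1) (by
    rw [htcard]; push_cast; rfl)
  let c : Kˣ × Kˣ := (a, b)
  let T : Finset (Kˣ × Kˣ) := htfin.toFinset.image (c * ·)
  have hTcard : T.card = 31 * 19 ^ (r + 1) + 1 := by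
    rw [Finset.card_image_of_injective _ (mul_right_injective c)]
    rw [htfin.encard_eq_coe_toFinset_card] at htcard
    exact_mod_cast htcard
  have hTmem (u) (hu : u ∈ T) : (u.1 + u.2 : K) = 1 ∧ ∃ g ∈ G, u = c * g := by
    obtain ⟨g, hg, rfl⟩ := Finset.mem_image.1 hu
    have := hts (htfin.mem_toFinset.1 hg)
    exact ⟨by simpa [c] using this.2, g, this.1, rfl⟩
  have htr (u) (hu : u ∈ T) : Transcendental (ZMod p) (u.1 : K) := by
    intro hal
    obtain ⟨h1, g, hg, rfl⟩ := hTmem u hu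
    obtain ⟨n, hn1, hnp, hn⟩ := exists_pow_eq_one_of_isAlgebraic h1 hal
    refine hab ⟨n, hn1, hnp, ?_⟩
    rw [mul_pow] at hn
    change c ^ n ∈ G
    rw [eq_inv_of_mul_eq_one_left hn]
    exact inv_mem (pow_mem hg n)
  obtain ⟨ι, w, K₀, hw, hTK, hK₀, hbig⟩ := exists_places (T.image fun u => (u.1 : K)) (by
    intro x hx
    obtain ⟨u, hu, rfl⟩ := Finset.mem_image.1 hx
    exact htr u hu)
  have hle := card_solutions_le (p := p) hw hK₀ T (fun u hu => (hTmem u hu).1)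
    (fun u hu => hTK (Finset.mem_image_of_mem _ hu))
    (fun u hu => hbig _ (Finset.mem_image_of_mem _ hu)) (R := r + 1) ?_ ?_
  · have : 0 < 19 ^ (r + 1) := by positivity
    lia
  · intro u hu u' hu' hne n hn
    obtain ⟨-, g, hg, rfl⟩ := hTmem u hu
    obtain ⟨-, g', hg', rfl⟩ := hTmem u' hu'
    rcases Nat.eq_zero_or_pos n with rfl | hn0
    · exact hne (by simpa using hn)
    have hpn : 1 < p ^ n := Nat.one_lt_pow hn0.ne' hp.one_lt
    refine hab ⟨p ^ n - 1, by lia, ?_, ?_⟩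
    · rw [Nat.coprime_comm, hp.coprime_iff_not_dvd]
      intro h
      have h' := (Nat.dvd_sub_iff_right hpn.le (dvd_pow_self p hn0.ne')).1 h
      exact hp.one_lt.ne' (Nat.dvd_one.1 h')
    · have e : c ^ (p ^ n - 1) = g' * (g ^ p ^ n)⁻¹ := by
        rw [eq_mul_inv_iff_mul_eq]
        refine mul_left_cancel (a := c) ?_
        rw [← hn, mul_pow, ← mul_assoc, ← pow_succ', Nat.sub_add_cancel hpn.le]
      change c ^ (p ^ n - 1) ∈ G
      rw [e]
      exact mul_mem hg' (inv_mem (pow_mem hg _))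
  · intro s
    let f : Additive G →+ LogSpace s := (logMap w s).comp G.subtype.toAdditive
    -- The coset representative `c` contributes one dimension beyond the rank.
    let V := Submodule.span ℝ (Set.range f) ⊔ Submodule.span ℝ {logMap w s (.ofMul c)}
    have hsub : Submodule.span ℝ ((fun u => logMap w s (.ofMul u)) '' (T : Set (Kˣ × Kˣ))) ≤ V := by
      rw [Submodule.span_le]
      rintro _ ⟨u, hu, rfl⟩
      obtain ⟨-, g, hg, rfl⟩ := hTmem u hu
      have e : logMap w s (.ofMul (c * g)) = f (.ofMul ⟨g, hg⟩) + logMap w s (.ofMul c) := by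
        rw [ofMul_mul, map_add, add_comm]; rfl
      simp only [e]
      exact add_mem (Submodule.mem_sup_left (Submodule.subset_span ⟨_, rfl⟩))
        (Submodule.mem_sup_right (Submodule.subset_span rfl))
    calc _ ≤ Module.finrank ℝ V := Submodule.finrank_mono hsub
      _ ≤ _ := Submodule.finrank_add_le_finrank_add_finrank _ _
      _ ≤ r + 1 := add_le_add (finrank_span_range_le_of_rank_eq hr f)
        ((finrank_span_le_card _).trans (by simp))
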